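/- **Theorem (Equivariant Thom isomorphism).** *Spectrum.* Let $\Theta_0,\Theta_1,\dots$ be an $\Omega$-spectrum with orthogonal actions: pointed spaces $\Theta_k$ (the basepoint is called the vacuum), each with a continuous basepoint-preserving action of $O(k)$, together with basepoint-preserving homotopy equivalences $$\epsilon_{n,m}:\mathrm{Hom}_*(S^n,\Theta_{n+m})\to\Theta_m\qquad(n,m\ge 0),$$ where $S^n=\mathbb R^n\cup\{\infty\}$ has basepoint $\infty$ and $\mathrm{Hom}_*$ is the space of based maps with the compact-open topology. Assume that $\epsilon_{n,m}$ is invariant under the diagonal action of $O(n)$ on source and target, i.e. $\epsilon_{n,m}(a\circ\alpha\circ a^{-1})=\epsilon_{n,m}(\alpha)$ for $a\in O(n)$, where $O(n)$ acts on $\Theta_{n+m}$ through the inclusion $O(n)\to O(n+m)$. *Group.* Let $G$ be a topological group (for example, a discrete group), let $EG$ be a contractible space with a continuous action of $G$ such that $EG\to BG=EG/G$ is a numerable principal $G$-bundle, and write $Y//G=(Y\times EG)/G$. Let $X=\mathbb R^n$ carry an orthogonal linear action of $G$, that is, a continuous homomorphism $\varphi:G\to O(n)$. *State bundle.* For $\bullet=n+m\ge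 n$, let $\mathfrak S_\bullet(T_GX)\to X//G$ be the state bundle of the equivariant tangent bundle $T_GX=TX//G$: its fibre at $b$ is $\mathrm{Hom}_{O(n)}(O(T_GX)_b,\Theta_\bullet)$, the space of $O(n)$-equivariant maps from the orthonormal frames at $b$ to $\Theta_\bullet$. It extends over $(X\cup\{\infty\})//G$ as the state bundle of $((X\cup\{\infty\})\times\mathbb R^n)//G$. Let $h_G^\bullet(X,\infty)$ be the set of homotopy classes of sections of $\mathfrak S_\bullet(T_GX)$ that extend continuously to $(X\cup\{\infty\})//G$ with the vacuum as value at the point at infinity (homotopies are through such sections, continuously up to infinity). Let $h_G^{\bullet-n}(pt)=h^{\bullet-n}(BG)$ be the set of homotopy classes of maps $BG\to\Theta_{\bullet-n}$. Then there is a bijection $$h_G^{\bullet}(X,\infty)\;\cong\;h_G^{\bullet-n}(pt),$$ which sends the class of the vacuum section to the class of the constant map to the vacuum. It sends the class of a section $s$ to the class of the map $BG\to\Theta_{\bullet-n}$, $[e]\mapsto\epsilon_{n,m}(\alpha_e)$, where $\alpha_e:S^n\to\Theta_\bullet$ is the based map whose value at $x\in X$ is the value of $s([x,e])$ in the standard frame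 of $T_xX=\mathbb R^n$. -/

import Mathlib

open Set Topology

/-! ### The orthogonal groups and their actions -/

/-- The orthogonal group `O(n)`, with its subspace topology in the space of matrices. -/
abbrev OrthGroup (n : ℕ) : Type := Matrix.orthogonalGroup (Fin n) ℝ

/-- Euclidean space `ℝ^n`. -/
abbrev EucSpace (n : ℕ) : Type := EuclideanSpace ℝ (Fin n)

/-- The sphere `S^n`, as the one-point compactification of `ℝ^n`; its basepoint is `∞`. -/
abbrev PtSphere (n : ℕ) : Type := OnePoint (EucSpace n)

/-- The action of `O(n)` on `ℝ^n` is multiplication of a matrix and a vector. -/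
theorem orth_smul_euc {n : ℕ} (A : OrthGroup n) (x : EucSpace n) :
    A • x = WithLp.toLp 2 (A.1.mulVec x.ofLp) := rfl

/-- The induced action of `O(n)` on `S^n = ℝ^n ∪ {∞}`, fixing `∞`. -/
noncomputable instance instOrthActSphere (n : ℕ) : MulAction (OrthGroup n) (PtSphere n) where
  smul A s := OnePoint.map (fun x : EucSpace n => A • x) s
  one_smul s := by
    change OnePoint.map (fun x : EucSpace n => (1 : OrthGroup n) • x) s = s
    simp only [one_smul]
    exact congrFun OnePoint.map_id s
  mul_smul A B s := by
    change OnePoint.map (fun x : EucSpace n => (A * B) • x) s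
      = OnePoint.map (fun x : EucSpace n => A • x) (OnePoint.map (fun x : EucSpace n => B • x) s)
    simp only [mul_smul]
    cases s <;> rfl

/-- The inclusion `O(n) → O(n + m)`, `A ↦ diag(A, 1)`. -/
noncomputable def orthIncl (n m : ℕ) : OrthGroup n →* OrthGroup (n + m) where
  toFun A := ⟨Matrix.reindex finSumFinEquiv finSumFinEquiv
      (Matrix.fromBlocks A.1 0 0 (1 : Matrix (Fin m) (Fin m) ℝ)), by
    have hA : A.1 * A.1.transpose = 1 := (Matrix.mem_orthogonalGroup_iff (Fin n) ℝ).1 A.2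
    rw [Matrix.mem_orthogonalGroup_iff, Matrix.reindex_apply, Matrix.transpose_submatrix,
      Matrix.submatrix_mul_equiv, Matrix.fromBlocks_transpose, Matrix.fromBlocks_multiply]
    simp [hA]⟩
  map_one' := by
    apply Subtype.ext
    simp
  map_mul' A B := by
    apply Subtype.ext
    simp only [Matrix.reindex_apply, Submonoid.coe_mul, Matrix.submatrix_mul_equiv,
      Matrix.fromBlocks_multiply]
    simp

/-! ### `Ω`-spectra with orthogonal actions -/

/-- `Hom_*(S^n, T)`: the continuous maps `S^n → T` that send `∞` to the basepoint `t₀`, with the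
compact-open topology. -/
abbrev PtMaps (n : ℕ) (T : Type*) [TopologicalSpace T] (t₀ : T) : Type _ :=
  {α : C(PtSphere n, T) // α OnePoint.infty = t₀}

/-- An `Ω`-spectrum `Θ_0, Θ_1, …` of pointed spaces with continuous basepoint-preserving actions of
`O(k)` on `Θ_k`, such that the pointed homotopy equivalences `Hom_*(S^n, Θ_{n+m}) → Θ_m` are
invariant under the diagonal action of `O(n)` on the source `S^n` and the target `Θ_{n+m}`,
i.e. under `α ↦ a ∘ α ∘ a⁻¹`. (For `n = 1` these are the equivalences `Ω Θ_{m+1} ≃ Θ_m`.) -/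
structure OrthOmegaSpectrum where
  /-- the spaces `Θ_k` -/
  space : ℕ → Type*
  [topology : ∀ k, TopologicalSpace (space k)]
  /-- the vacuum state, the basepoint of `Θ_k` -/
  vac : ∀ k, space k
  [action : ∀ k, MulAction (OrthGroup k) (space k)]
  [continuous_action : ∀ k, ContinuousSMul (OrthGroup k) (space k)]
  smul_vac : ∀ k (a : OrthGroup k), a • vac k = vac k
  /-- the equivalence `Hom_*(S^n, Θ_{n+m}) → Θ_m` -/
  deloop : ∀ n m, C(PtMaps n (space (n + m)) (vac (n + m)), space m)
  deloop_equiv : ∀ n m, ∃ h : ContinuousMap.HomotopyEquiv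
    (PtMaps n (space (n + m)) (vac (n + m))) (space m), h.toFun = deloop n m
  deloop_vac : ∀ n m, deloop n m ⟨ContinuousMap.const _ (vac (n + m)), rfl⟩ = vac m
  deloop_invariant : ∀ n m (a : OrthGroup n) (α β : PtMaps n (space (n + m)) (vac (n + m))),
    (∀ s, β.1 (a • s) = orthIncl n m a • α.1 s) → deloop n m β = deloop n m α

attribute [instance] OrthOmegaSpectrum.topology OrthOmegaSpectrum.action
  OrthOmegaSpectrum.continuous_action

/-! ### Classifying spaces and homotopy quotients -/

/-- The classifying space `BG = EG / G`. -/
abbrev ClassSpace (G EG : Type*) [Group G] [MulAction G EG] : Type _ :=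
  MulAction.orbitRel.Quotient G EG

/-- The projection `EG → BG`. -/
def toClassSpace (G : Type*) {EG : Type*} [Group G] [MulAction G EG] (e : EG) : ClassSpace G EG :=
  Quotient.mk (MulAction.orbitRel G EG) e

/-- `EG` is a total space of a universal principal `G`-bundle: it is contractible, and
`EG → EG / G` is a numerable principal `G`-bundle, i.e. it is trivial over the members of an open
cover of the base that has a subordinate partition of unity. -/
structure IsUniversalBundle.{u, v} (G : Type u) (EG : Type v) [Group G] [TopologicalSpace G]
    [TopologicalSpace EG] [MulAction G EG] : Prop where
  contractible : ContractibleSpace EG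
  numerable : ∃ (ι : Type v) (U : ι → Set (ClassSpace G EG))
    (ρ : PartitionOfUnity ι (ClassSpace G EG)),
    (∀ i, IsOpen (U i)) ∧ ρ.IsSubordinate U ∧
    ∀ i, ∃ h : (U i × G) ≃ₜ (toClassSpace G (EG := EG) ⁻¹' U i),
      (∀ b g, toClassSpace G (h (b, g)).1 = b.1) ∧
      ∀ b g g', (h (b, g' * g)).1 = g' • (h (b, g)).1

section HomotopyQuotient

variable {G : Type*} [Group G] {n : ℕ} (φ : G →* OrthGroup n)
  (Y : Type*) [MulAction (OrthGroup n) Y] (EG : Type*) [MulAction G EG]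

/-- The orbit relation of the diagonal action of `G` on `Y × EG`, where `G` acts on `Y` through
`φ : G → O(n)`. -/
def hqSetoid : Setoid (Y × EG) where
  r p q := ∃ g : G, (φ g • p.1, g • p.2) = q
  iseqv :=
    { refl := fun p => ⟨1, by simp⟩
      symm := by
        rintro p q ⟨g, rfl⟩
        exact ⟨g⁻¹, by simp [smul_smul]⟩
      trans := by
        rintro p q r ⟨g, rfl⟩ ⟨g', rfl⟩
        exact ⟨g' * g, by simp [smul_smul, ← map_mul]⟩ }

/-- The homotopy quotient `Y // G = (Y × EG) / G`, where `G` acts on `Y` through `φ : G → O(n)`. -/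
def HQ : Type _ := Quotient (hqSetoid φ Y EG)

instance [TopologicalSpace Y] [TopologicalSpace EG] : TopologicalSpace (HQ φ Y EG) :=
  inferInstanceAs (TopologicalSpace (Quotient (hqSetoid φ Y EG)))

variable {Y EG}

/-- The class `[y, e]` in `Y // G`. -/
def HQ.mk (y : Y) (e : EG) : HQ φ Y EG := Quotient.mk (hqSetoid φ Y EG) (y, e)

end HomotopyQuotient

/-! ### The equivariant frame bundle

For `Y = ℝ^n` with `G` acting through `φ : G → O(n)`, every tangent space is `ℝ^n`, and the
derivative of the action of `g` is `φ g`. So `TY = Y × ℝ^n` with `g (y, v) = (φ g y, φ g v)`, an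
orthonormal frame at `y`, seen as an isometry `u : T_y Y → ℝ^n`, is an element of `O(n)`, and `g`
takes the frame `u` at `y` to the frame `u ∘ (φ g)⁻¹` at `φ g y`. The same formulas extend
this bundle to `Y = ℝ^n ∪ {∞}`. -/

/-- The bundle of frames `(y, u)` over `Y`. -/
def Frames (n : ℕ) (Y : Type*) : Type _ := Y × OrthGroup n

instance (n : ℕ) (Y : Type*) [TopologicalSpace Y] : TopologicalSpace (Frames n Y) :=
  inferInstanceAs (TopologicalSpace (Y × OrthGroup n))

/-- Symmetries move the base point and the frame: `A (y, u) = (A y, u ∘ A⁻¹)`. -/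
noncomputable instance (n : ℕ) (Y : Type*) [MulAction (OrthGroup n) Y] :
    MulAction (OrthGroup n) (Frames n Y) where
  smul A p := (A • p.1, p.2 * A⁻¹)
  one_smul p := by
    change ((1 : OrthGroup n) • p.1, p.2 * 1⁻¹) = (p.1, p.2)
    simp
  mul_smul A B p := by
    change ((A * B) • p.1, p.2 * (A * B)⁻¹) = (A • B • p.1, p.2 * B⁻¹ * A⁻¹)
    simp [mul_smul, mul_assoc]

section FrameBundle

variable {G : Type*} [Group G] {n : ℕ} (φ : G →* OrthGroup n)
  (Y : Type*) [MulAction (OrthGroup n) Y] (EG : Type*) [MulAction G EG]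

/-- The orthonormal frame bundle of the vector bundle `(Y × ℝ^n) // G → Y // G`. -/
def FrameBundle : Type _ := HQ φ (Frames n Y) EG

instance [TopologicalSpace Y] [TopologicalSpace EG] : TopologicalSpace (FrameBundle φ Y EG) :=
  inferInstanceAs (TopologicalSpace (HQ φ (Frames n Y) EG))

variable {Y EG}

/-- The frame `[y, u, e]` at the point `[y, e]` of `Y // G`. -/
noncomputable def FrameBundle.mk (y : Y) (u : OrthGroup n) (e : EG) : FrameBundle φ Y EG :=
  HQ.mk φ (Y := Frames n Y) (y, u) e

variable {φ}

/-- The projection `[y, u, e] ↦ [y, e]`. -/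
noncomputable def FrameBundle.proj : FrameBundle φ Y EG → HQ φ Y EG :=
  Quotient.map' (fun p => (p.1.1, p.2)) (by
    rintro p q ⟨g, rfl⟩
    exact ⟨g, rfl⟩)

/-- The structure group `O(n)` acts on frames by `a [y, u, e] = [y, a ∘ u, e]`. -/
noncomputable instance : SMul (OrthGroup n) (FrameBundle φ Y EG) where
  smul a := Quotient.map' (fun p => (((p.1.1, a * p.1.2) : Frames n Y), p.2)) (by
    rintro p q ⟨g, rfl⟩
    refine ⟨g, ?_⟩
    change (((φ g • p.1.1, a * p.1.2 * (φ g)⁻¹) : Frames n Y), g • p.2)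
      = (((φ g • p.1.1, a * (p.1.2 * (φ g)⁻¹)) : Frames n Y), g • p.2)
    rw [mul_assoc])

end FrameBundle

/-! ### The state bundle -/

section StateBundle

variable (Θ : OrthOmegaSpectrum) (n m : ℕ) {P B : Type*} [SMul (OrthGroup n) P] (π : P → B)

/-- The fibre `Hom_{O(n)}(P_b, Θ_{n+m})` of the state bundle of a frame bundle `π : P → B`;
`O(n)` acts on `Θ_{n+m}` through `O(n) → O(n + m)`. (As `P_b` is one orbit, such maps are
automatically continuous.) -/
structure StateFibre (b : B) where
  /-- the value at a frame -/
  val : {p : P // π p = b} → Θ.space (n + m)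
  equivariant : ∀ (a : OrthGroup n) (p q : {p : P // π p = b}), q.1 = a • p.1 →
    val q = orthIncl n m a • val p

/-- The total space of the state bundle. -/
def StateBundle : Type _ := Σ b : B, StateFibre Θ n m π b

/-- The pullback of the state bundle to the frame bundle. -/
def StatePullback : Type _ := {z : P × StateBundle Θ n m π // π z.1 = z.2.1}

/-- Over the frame bundle, the state bundle is trivialized by `(p, σ) ↦ (p, σ(p))`. -/
def StatePullback.triv (z : StatePullback Θ n m π) : P × Θ.space (n + m) :=
  (z.1.1, z.1.2.2.val ⟨z.1.1, z.2⟩)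

/-- The topology of the pullback is that of `P × Θ_{n+m}`. -/
instance [TopologicalSpace P] : TopologicalSpace (StatePullback Θ n m π) :=
  TopologicalSpace.induced (StatePullback.triv Θ n m π) inferInstance

/-- The topology of the associated bundle: the quotient topology from the pullback of the state
bundle to the frame bundle. -/
instance [TopologicalSpace P] : TopologicalSpace (StateBundle Θ n m π) :=
  TopologicalSpace.coinduced (fun z : StatePullback Θ n m π => z.1.2) inferInstance

variable {Θ n m π}

/-- `s` is a section of the state bundle. -/
def IsStateSection (s : B → StateBundle Θ n m π) : Prop := ∀ b, (s b).1 = b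

/-- The value in `Θ_{n+m}` of a section, with respect to a frame `p`. -/
def IsStateSection.eval {s : B → StateBundle Θ n m π} (hs : IsStateSection s) (p : P) :
    Θ.space (n + m) :=
  (s (π p)).2.val ⟨p, (hs (π p)).symm⟩

theorem IsStateSection.ext {s t : B → StateBundle Θ n m π} (hs : IsStateSection s)
    (ht : IsStateSection t) (h : ∀ p, hs.eval p = ht.eval p) : s = t := by
  funext b
  have key : ∀ (x y : StateBundle Θ n m π) (hx : x.1 = b) (hy : y.1 = b),
      (∀ p (hp : π p = b), x.2.val ⟨p, hp.trans hx.symm⟩ = y.2.val ⟨p, hp.trans hy.symm⟩) →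
        x = y := by
    rintro ⟨b₁, σ⟩ ⟨b₂, τ⟩ hx hy h
    dsimp only at hx hy
    subst hx
    subst hy
    obtain ⟨σ, _⟩ := σ
    obtain ⟨τ, _⟩ := τ
    obtain rfl : σ = τ := funext fun p => h p.1 p.2
    rfl
  refine key (s b) (t b) (hs b) (ht b) ?_
  rintro p rfl
  exact h p

end StateBundle

/-! ### Cohomology -/

/-- The homotopy classes `[S, T]` of continuous maps `S → T`. -/
def HtpyClasses (S T : Type*) [TopologicalSpace S] [TopologicalSpace T] : Type _ :=
  Quotient (⟨ContinuousMap.Homotopic, ContinuousMap.Homotopic.equivalence⟩ : Setoid C(S, T))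

/-- The homotopy class of a map. -/
def HtpyClasses.mk {S T : Type*} [TopologicalSpace S] [TopologicalSpace T] (f : C(S, T)) :
    HtpyClasses S T :=
  Quotient.mk _ f

section Cohomology

variable (Θ : OrthOmegaSpectrum) {G : Type*} [Group G] {n : ℕ} (m : ℕ) (φ : G →* OrthGroup n)
  (EG : Type*) [MulAction G EG]

/-- The state bundle over `X // G`, `X = ℝ^n`, of the equivariant tangent bundle `TX // G`. -/
abbrev StateX : Type _ :=
  StateBundle Θ n m (FrameBundle.proj (φ := φ) (Y := EucSpace n) (EG := EG))

/-- The extension of the state bundle to `(X ∪ {∞}) // G`. -/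
abbrev StateXInf : Type _ :=
  StateBundle Θ n m (FrameBundle.proj (φ := φ) (Y := PtSphere n) (EG := EG))

variable [TopologicalSpace EG]

variable {Θ m φ EG}

/-- `t` is a section over `(X ∪ {∞}) // G` that is the vacuum at infinity. -/
def IsTrivAtInf (t : C(HQ φ (PtSphere n) EG, StateXInf Θ m φ EG)) : Prop :=
  ∃ ht : IsStateSection t, ∀ (u : OrthGroup n) (e : EG),
    ht.eval (FrameBundle.mk φ OnePoint.infty u e) = Θ.vac (n + m)

/-- The section `t` over `(X ∪ {∞}) // G` is the vacuum at infinity and extends the section `s`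
over `X // G`. -/
def Extends (t : C(HQ φ (PtSphere n) EG, StateXInf Θ m φ EG))
    (s : {s : C(HQ φ (EucSpace n) EG, StateX Θ m φ EG) // IsStateSection s}) : Prop :=
  IsTrivAtInf t ∧ ∃ ht : IsStateSection t, ∀ (x : EucSpace n) (u : OrthGroup n) (e : EG),
    ht.eval (FrameBundle.mk φ (x : PtSphere n) u e) = s.2.eval (FrameBundle.mk φ x u e)

theorem Extends.unique {t t' : C(HQ φ (PtSphere n) EG, StateXInf Θ m φ EG)}
    {s : {s : C(HQ φ (EucSpace n) EG, StateX Θ m φ EG) // IsStateSection s}}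
    (h : Extends t s) (h' : Extends t' s) : t = t' := by
  obtain ⟨⟨ht, h1⟩, _, h2⟩ := h
  obtain ⟨⟨ht', h1'⟩, _, h2'⟩ := h'
  apply DFunLike.coe_injective
  refine ht.ext ht' ?_
  rintro ⟨⟨⟨y, u⟩, e⟩⟩
  induction y using OnePoint.rec with
  | infty => exact (h1 u e).trans (h1' u e).symm
  | coe x => exact (h2 x u e).trans (h2' x u e).symm

variable (Θ m φ EG)

/-- The sections of the state bundle over `X // G` that extend to the one-point compactification
of `X` with trivial value at the point at infinity. -/
def SectionsXInf : Type _ :=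
  {s : {s : C(HQ φ (EucSpace n) EG, StateX Θ m φ EG) // IsStateSection s} // ∃ t, Extends t s}

/-- Homotopy of such sections, through such sections: their extensions are homotopic through
sections over `(X ∪ {∞}) // G` that are trivial at infinity. -/
def sectionsSetoid : Setoid (SectionsXInf Θ m φ EG) where
  r s s' := ∃ t t', Extends t s.1 ∧ Extends t' s'.1 ∧
    ContinuousMap.HomotopicWith t t' IsTrivAtInf
  iseqv :=
    { refl := by
        rintro ⟨s, t, ht⟩
        exact ⟨t, t, ht, ht, .refl t ht.1⟩
      symm := by
        rintro s s' ⟨t, t', h, h', H⟩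
        exact ⟨t', t, h', h, H.symm⟩
      trans := by
        rintro s s' s'' ⟨t, t', h, h', H⟩ ⟨t₁, t₁', k, k', K⟩
        obtain rfl := h'.unique k
        exact ⟨t, t₁', h, k', H.trans K⟩ }

/-- `h_G^{n+m}(X, ∞)`: homotopy classes of sections of the state bundle over `X // G` that extend
to the one-point compactification of `X` with trivial value at the point at infinity. -/
def EquivCohXInf : Type _ := Quotient (sectionsSetoid Θ m φ EG)

variable {Θ m φ EG}

/-- The homotopy class of a section. -/
def EquivCohXInf.mk (s : SectionsXInf Θ m φ EG) : EquivCohXInf Θ m φ EG := Quotient.mk _ s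

end Cohomology

/-! ### The vacuum section -/

section Vacuum

variable (Θ : OrthOmegaSpectrum) {G : Type*} [Group G] {n : ℕ} (m : ℕ) (φ : G →* OrthGroup n)
  (Y : Type*) [MulAction (OrthGroup n) Y] [TopologicalSpace Y]
  (EG : Type*) [MulAction G EG] [TopologicalSpace EG]

/-- The vacuum state in the fibre over `b`. -/
def vacState (b : HQ φ Y EG) :
    StateBundle Θ n m (FrameBundle.proj (φ := φ) (Y := Y) (EG := EG)) :=
  ⟨b, fun _ => Θ.vac (n + m), fun _ _ _ _ => (Θ.smul_vac (n + m) _).symm⟩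

/-- The section of the state bundle over `Y // G` that is everywhere the vacuum. -/
noncomputable def vacSection : C(HQ φ Y EG,
    StateBundle Θ n m (FrameBundle.proj (φ := φ) (Y := Y) (EG := EG))) where
  toFun := vacState Θ m φ Y EG
  continuous_toFun := by
    have hq : IsQuotientMap (FrameBundle.proj (φ := φ) (Y := Y) (EG := EG)) := by
      have h1 : IsQuotientMap (fun p : Frames n Y × EG => (p.1.1, p.2)) := by
        apply IsOpenQuotientMap.isQuotientMap
        refine (IsOpenQuotientMap.prodMap (f := fun p : Frames n Y => p.1) (g := (id : EG → EG))
          ?_ IsOpenQuotientMap.id)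
        exact ⟨fun y => ⟨(y, 1), rfl⟩, continuous_fst, isOpenMap_fst⟩
      have h2 : IsQuotientMap (fun p : Y × EG => HQ.mk φ p.1 p.2) := isQuotientMap_quot_mk
      have h3 : Continuous (fun p : Frames n Y × EG => (Quotient.mk _ p : FrameBundle φ Y EG)) :=
        continuous_quot_mk
      refine IsQuotientMap.of_comp h3 ?_ (h2.comp h1)
      exact Continuous.quotient_map' (h1.continuous) _
    rw [hq.continuous_iff]
    let z : FrameBundle φ Y EG →
        StatePullback Θ n m (FrameBundle.proj (φ := φ) (Y := Y) (EG := EG)) :=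
      fun p => ⟨(p, vacState Θ m φ Y EG p.proj), rfl⟩
    have hz : Continuous z := by
      rw [continuous_induced_rng]
      exact continuous_id.prodMk continuous_const
    have hc : Continuous (fun w : StatePullback Θ n m
        (FrameBundle.proj (φ := φ) (Y := Y) (EG := EG)) => w.1.2) := continuous_coinduced_rng
    exact hc.comp hz

/-- The vacuum section over `X // G`; it extends to infinity. -/
noncomputable def vacSectionXInf : SectionsXInf Θ m φ EG :=
  ⟨⟨vacSection Θ m φ (EucSpace n) EG, fun _ => rfl⟩, vacSection Θ m φ (PtSphere n) EG,
    ⟨fun _ => rfl, fun _ _ => rfl⟩, fun _ => rfl, fun _ _ _ => rfl⟩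

end Vacuum

/-!
A section of the state bundle over `(X ∪ {∞}) // G` which is the vacuum at infinity is the same as
an equivariant map from `EG` to `Hom_*(S^n, Θ_{n+m})`, on which `G` acts by conjugation: its value
at `e` lists the values of the section at the points `[x, e]` in the standard frame
(`exists_equivariant_of_sections`, `exists_sections_of_equivariant`). Continuity of these values
comes from the continuity of the translation function of the principal bundle `EG → BG`
(`continuous_state_val`). A map from `BG` to `Θ_m` is an invariant map on `EG`. So the theorem
says that composition with the invariant map `d = deloop n m : Hom_*(S^n, Θ_{n+m}) → Θ_m` is a
bijection from equivariant homotopy classes of equivariant maps on `EG` to homotopy classes of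
invariant maps.

The map `d` is a homotopy equivalence, but not an equivariant one, and this is where the numerable
local trivializations of `EG` enter, as in Dold's theorem on fibre homotopy equivalences. Replace
`d` by the fibration `last d : MapPath d → Θ_m` on the mapping path space. As `d` is a homotopy
equivalence, `MapPath d` contracts over `Θ_m` onto a section (`exists_vertical_contraction`). Over
a trivial piece of `EG` this contraction can be made equivariant. Such local contractions are
applied one after the other, in a fixed linear order of the index set of the cover, each for a
time that depends on the partition of unity. Where all earlier weights are small compared with the
weight of a piece, the contraction of this piece forgets the point it is applied to, and where its
own weight is not the largest so far, it does nothing; so the result is continuous and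
equivariant, however the starting point was chosen (`TrivialCover.exists_equivariant_lift`). This
lifts invariant maps to equivariant ones up to homotopy
(`exists_equivariant_lift_of_homotopyEquiv`), which is surjectivity. Injectivity is the same
statement on `I × EG`, with the lift prescribed near the two ends (`exists_equivariant_homotopy`).
-/

open scoped unitInterval

/-! ### Mapping path spaces and vertical contractions -/

section MappingPathSpace

variable {P T : Type*} [TopologicalSpace P] [TopologicalSpace T]

/-- The mapping path space of `d : P → T`: points `x` of `P` with a path in `T` that starts at
`d x`. -/
abbrev MapPath (d : C(P, T)) : Type _ := {w : P × C(I, T) // w.2 0 = d w.1}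

namespace MapPath

/-- The end of the path; this is the fibration that replaces `d`. -/
def last (d : C(P, T)) : C(MapPath d, T) where
  toFun w := w.1.2 1
  continuous_toFun := by fun_prop

/-- The pairs of composable paths. -/
abbrev Composable (T : Type*) [TopologicalSpace T] : Type _ :=
  {q : C(I, T) × C(I, T) // q.1 1 = q.2 0}

/-- The path `γ` followed by the part of `δ` over `[0, t]`, both traversed with speed `1 + t`. -/
noncomputable def append : C(Composable T × I, C(I, T)) :=
  ContinuousMap.curry
    { toFun := fun z => if (z.2 : ℝ) * (1 + (z.1.2 : ℝ)) ≤ 1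
        then z.1.1.1.1 (projIcc 0 1 zero_le_one ((z.2 : ℝ) * (1 + (z.1.2 : ℝ))))
        else z.1.1.1.2 (projIcc 0 1 zero_le_one ((z.2 : ℝ) * (1 + (z.1.2 : ℝ)) - 1))
      continuous_toFun := by
        refine Continuous.if_le ?_ ?_ (by fun_prop) continuous_const ?_
        · have : Continuous fun z : (Composable T × I) × I =>
            (z.1.1.1.1, projIcc (0 : ℝ) 1 zero_le_one ((z.2 : ℝ) * (1 + (z.1.2 : ℝ)))) := by
            refine Continuous.prodMk (by fun_prop) (continuous_projIcc.comp (by fun_prop))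
          exact ContinuousEval.continuous_eval.comp this
        · have : Continuous fun z : (Composable T × I) × I =>
            (z.1.1.1.2, projIcc (0 : ℝ) 1 zero_le_one ((z.2 : ℝ) * (1 + (z.1.2 : ℝ)) - 1)) := by
            refine Continuous.prodMk (by fun_prop) (continuous_projIcc.comp (by fun_prop))
          exact ContinuousEval.continuous_eval.comp this
        · intro z hz
          have := z.1.1.2
          rw [hz, sub_self, projIcc_right, projIcc_left]
          exact this }

theorem append_apply (q : Composable T) (t s : I) :
    append (q, t) s = if (s : ℝ) * (1 + (t : ℝ)) ≤ 1
        then q.1.1 (projIcc 0 1 zero_le_one ((s : ℝ) * (1 + (t : ℝ))))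
        else q.1.2 (projIcc 0 1 zero_le_one ((s : ℝ) * (1 + (t : ℝ)) - 1)) := rfl

theorem append_time_zero (q : Composable T) : append (q, 0) = q.1.1 := by
  ext s
  rw [append_apply, if_pos (by simpa using s.2.2)]
  congr 1
  simp

theorem append_start (q : Composable T) (t : I) : append (q, t) 0 = q.1.1 0 := by
  rw [append_apply, if_pos (by simp)]
  congr 1
  simp

theorem append_end (q : Composable T) (t : I) : append (q, t) 1 = q.1.2 t := by
  rw [append_apply]
  split_ifs with h
  · have h0 : t = 0 := by
      apply Subtype.ext
      have := t.2.1
      simp at h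
      simpa using le_antisymm h this
    subst h0
    simpa using q.2
  · congr 1
    simp

variable (d : C(P, T))

/-- Points of the mapping path space with a path in `T` that starts at their end. -/
abbrev LiftData : Type _ := {p : MapPath d × C(I, T) // last d p.1 = p.2 0}

/-- The path lifting function of the fibration `last d`. -/
noncomputable def transport : C(LiftData d × I, MapPath d) where
  toFun z := ⟨(z.1.1.1.1.1, append (⟨(z.1.1.1.1.2, z.1.1.2), z.1.2⟩, z.2)), by
    rw [append_start]
    exact z.1.1.1.2⟩
  continuous_toFun := by
    refine Continuous.subtype_mk (Continuous.prodMk (by fun_prop) (append.continuous.comp ?_)) _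
    exact Continuous.prodMk (Continuous.subtype_mk (by fun_prop) _) (by fun_prop)

theorem transport_zero (p : LiftData d) : transport d (p, 0) = p.1.1 := by
  apply Subtype.ext
  exact Prod.ext rfl (append_time_zero _)

theorem last_transport (p : LiftData d) (t : I) : last d (transport d (p, t)) = p.1.2 t :=
  append_end _ _

/-- A self-map of the mapping path space over `T`. -/
def IsVertical (g : C(MapPath d, MapPath d)) : Prop := ∀ w, last d (g w) = last d w

variable {d}

/-- The path `u ↦ last (M (s (1 - u), w))`, which runs back from the end of `M (s, w)` to the end of
`M (0, w)`. -/
def backPath (M : C(I × MapPath d, MapPath d)) : C(I × MapPath d, C(I, T)) :=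
  ContinuousMap.curry
    ⟨fun z => last d (M (z.1.1 * σ z.2, z.1.2)), by fun_prop⟩

/-- The point `M (s, w)`, moved by path lifting along `backPath M (s, w)` for the time `t`. -/
noncomputable def pullBack (M : C(I × MapPath d, MapPath d)) :
    C((I × MapPath d) × I, MapPath d) where
  toFun z := transport d (⟨(M z.1, backPath M z.1), by
    change last d (M z.1) = last d (M (z.1.1 * σ 0, z.1.2))
    simp⟩, z.2)
  continuous_toFun := by
    refine (transport d).continuous.comp (Continuous.prodMk (Continuous.subtype_mk ?_ _) ?_)
    all_goals fun_prop

theorem last_pullBack (M : C(I × MapPath d, MapPath d)) (s : I) (w : MapPath d) (t : I) :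
    last d (pullBack M ((s, w), t)) = last d (M (s * σ t, w)) :=
  last_transport _ _ _

/-- A homotopy whose start is vertical can be straightened: the start is vertically homotopic to
the end, moved back along the track of the homotopy in `T`. -/
theorem homotopicWith_pullBack (M : C(I × MapPath d, MapPath d))
    (hM : ∀ w, last d (M (0, w)) = last d w) :
    ContinuousMap.HomotopicWith (⟨fun w => M (0, w), by fun_prop⟩ : C(MapPath d, MapPath d))
      ⟨fun w => pullBack M ((1, w), 1), by fun_prop⟩ (IsVertical d) := by
  have h1 : ContinuousMap.HomotopicWith
      (⟨fun w => M (0, w), by fun_prop⟩ : C(MapPath d, MapPath d))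
      ⟨fun w => pullBack M ((0, w), 1), by fun_prop⟩ (IsVertical d) :=
    ⟨{ toFun := fun z => pullBack M ((0, z.2), z.1)
       map_zero_left := fun w => transport_zero _ _
       map_one_left := fun w => rfl
       prop' := fun t w => by
        change last d (pullBack M ((0, w), t)) = _
        rw [last_pullBack, zero_mul, hM] }⟩
  have h2 : ContinuousMap.HomotopicWith
      (⟨fun w => pullBack M ((0, w), 1), by fun_prop⟩ : C(MapPath d, MapPath d))
      ⟨fun w => pullBack M ((1, w), 1), by fun_prop⟩ (IsVertical d) :=
    ⟨{ toFun := fun z => pullBack M (z, 1)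
       map_zero_left := fun w => rfl
       map_one_left := fun w => rfl
       prop' := fun t w => by
        change last d (pullBack M ((t, w), 1)) = _
        rw [last_pullBack, unitInterval.symm_one, mul_zero, hM] }⟩
  exact h1.trans h2

/-- If `k` is a section of `last d` and `k ∘ last d` is homotopic to the identity, then it is so
over `T`: the given homotopy `L` and its image under `k ∘ last d` have the same track in `T` and the
same end, so that straightening both of them gives the same map. -/
theorem homotopicWith_of_homotopic (k : C(T, MapPath d)) (hk : ∀ y, last d (k y) = y)
    (h : ContinuousMap.Homotopic (ContinuousMap.id _) (k.comp (last d))) :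
    ContinuousMap.HomotopicWith (ContinuousMap.id _) (k.comp (last d)) (IsVertical d) := by
  obtain ⟨L⟩ := h
  have h1 := homotopicWith_pullBack L.toContinuousMap (fun w => by
    change last d (L (0, w)) = _
    simp)
  have h2 := homotopicWith_pullBack ((k.comp (last d)).comp L.toContinuousMap) (fun w => by
    change last d (k (last d (L (0, w)))) = _
    simp [hk])
  have e1 : (⟨fun w => L.toContinuousMap (0, w), by fun_prop⟩ : C(MapPath d, MapPath d)) =
      ContinuousMap.id _ := by
    ext1 w
    exact L.apply_zero w
  have e2 : (⟨fun w => ((k.comp (last d)).comp L.toContinuousMap) (0, w), by fun_prop⟩ :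
      C(MapPath d, MapPath d)) = k.comp (last d) := by
    ext1 w
    change k (last d (L (0, w))) = _
    simp
  have e3 : ∀ w, pullBack ((k.comp (last d)).comp L.toContinuousMap) ((1, w), 1)
      = pullBack L.toContinuousMap ((1, w), 1) := by
    intro w
    refine congrArg (fun p => transport d (p, 1)) (Subtype.ext (Prod.ext ?_ ?_))
    · change k (last d (L (1, w))) = L (1, w)
      simp [hk]
    · ext u
      exact hk _
  rw [e1] at h1
  rw [e2] at h2
  simp only [e3] at h2
  exact h1.trans h2.symm

end MapPath

open MapPath in
/-- The mapping path space of a homotopy equivalence `d : P → T` contracts over `T` onto a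
section. -/
theorem exists_vertical_contraction (h : ContinuousMap.HomotopyEquiv P T) (d : C(P, T))
    (hd : h.toFun = d) :
    ∃ (k : C(T, MapPath d)) (D : C(MapPath d × I, MapPath d)),
      (∀ y, last d (k y) = y) ∧ (∀ w, D (w, 0) = w) ∧ (∀ w, D (w, 1) = k (last d w)) ∧
      ∀ w t, last d (D (w, t)) = last d w := by
  subst hd
  set d := h.toFun
  set d' := h.invFun
  obtain ⟨K⟩ := h.right_inv
  -- the path `K (·, y)` joins `d (d' y)` and `y`
  let k : C(T, MapPath d) :=
    { toFun := fun y => ⟨(d' y, (K.toContinuousMap.comp ContinuousMap.prodSwap).curry y),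
        K.apply_zero y⟩
      continuous_toFun := by fun_prop }
  have hk : ∀ y, last d (k y) = y := fun y => K.apply_one y
  have k_path : ∀ y s, (k y).1.2 s = K (s, y) := fun _ _ => rfl
  let c : C(T, C(I, T)) := ContinuousMap.curry ⟨fun z => z.1, by fun_prop⟩
  let j : C(P, MapPath d) :=
    { toFun := fun x => ⟨(x, c (d x)), rfl⟩
      continuous_toFun := by fun_prop }
  let p : C(MapPath d, P) := ⟨fun w => w.1.1, by fun_prop⟩
  -- reparametrization of paths by `s ↦ s t`
  let sc : C(C(I, T) × I, C(I, T)) :=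
    ContinuousMap.curry ⟨fun z => z.1.1 (z.2 * z.1.2), by fun_prop⟩
  have sc_apply : ∀ γ t s, sc (γ, t) s = γ (s * t) := fun _ _ _ => rfl
  have h1 : (j.comp p).Homotopic (ContinuousMap.id (MapPath d)) :=
    ⟨{ toFun := fun z => ⟨(z.2.1.1, sc (z.2.1.2, z.1)), by
        rw [sc_apply, zero_mul]; exact z.2.2⟩
       continuous_toFun := by fun_prop
       map_zero_left := fun w => by
        refine Subtype.ext (Prod.ext rfl ?_)
        ext s
        change w.1.2 (s * 0) = d w.1.1
        rw [mul_zero, w.2]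
       map_one_left := fun w => by
        refine Subtype.ext (Prod.ext rfl ?_)
        ext s
        change w.1.2 (s * 1) = w.1.2 s
        rw [mul_one] }⟩
  have h2 : (j.comp p).Homotopic (j.comp ((d'.comp d).comp p)) :=
    (ContinuousMap.Homotopic.refl j).comp
      (h.left_inv.symm.comp (ContinuousMap.Homotopic.refl p))
  have h3 : (j.comp d').Homotopic k :=
    ⟨{ toFun := fun z => ⟨(d' z.2, sc ((k z.2).1.2, z.1)), by
        rw [sc_apply, zero_mul]; exact (k z.2).2⟩
       continuous_toFun := by fun_prop
       map_zero_left := fun y => by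
        refine Subtype.ext (Prod.ext rfl ?_)
        ext s
        change (k y).1.2 (s * 0) = d (d' y)
        rw [mul_zero]
        exact (k y).2
       map_one_left := fun y => by
        refine Subtype.ext (Prod.ext rfl ?_)
        ext s
        change (k y).1.2 (s * 1) = _
        rw [mul_one] }⟩
  have h4 : (d.comp p).Homotopic (last d) :=
    ⟨{ toFun := fun z => z.2.1.2 z.1
       continuous_toFun := by fun_prop
       map_zero_left := fun w => w.2
       map_one_left := fun w => rfl }⟩
  have h5 : ContinuousMap.Homotopic (ContinuousMap.id _) (k.comp (last d)) :=
    (h1.symm.trans h2).trans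
      (((h3.comp (ContinuousMap.Homotopic.refl (d.comp p)))).trans
        ((ContinuousMap.Homotopic.refl k).comp h4))
  obtain ⟨D⟩ := homotopicWith_of_homotopic k hk h5
  refine ⟨k, D.toHomotopy.toContinuousMap.comp ContinuousMap.prodSwap, hk, fun w => D.apply_zero w,
    fun w => D.apply_one w, fun w t => D.prop t w⟩

end MappingPathSpace

/-! ### Gluing equivariant lifts along a numerable cover -/

/-- A numerable cover of a `G`-space `E` by open sets `{weight i > 0}` that are trivial, i.e. carry
equivariant maps `coord i` to `G`. Outside of `{weight i > 0}`, `coord i` is arbitrary. The weights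
need not add up to `1`. -/
structure TrivialCover (ι G E : Type*) [Group G] [TopologicalSpace G] [TopologicalSpace E]
    [MulAction G E] where
  /-- the functions that define the cover -/
  weight : ι → E → ℝ
  continuous_weight : ∀ i, Continuous (weight i)
  weight_nonneg : ∀ i e, 0 ≤ weight i e
  weight_le_one : ∀ i e, weight i e ≤ 1
  locallyFinite : LocallyFinite fun i => Function.support (weight i)
  exists_pos : ∀ e, ∃ i, 0 < weight i e
  weight_smul : ∀ i (g : G) e, weight i (g • e) = weight i e
  /-- the equivariant maps to `G` -/
  coord : ι → E → G
  continuousAt_coord : ∀ i e, 0 < weight i e → ContinuousAt (coord i) e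
  coord_smul : ∀ i (g : G) e, 0 < weight i e → coord i (g • e) = g * coord i e

/-- The time for which a contraction is applied when an old weight is `b` and a new weight is `a`:
it is `0` for `a ≤ b` and `1` for `3 b ≤ a`, and, for nonnegative `a` and `b`,
continuous away from `a = b = 0`. -/
noncomputable def mixTime (a b : ℝ) : I := projIcc 0 1 zero_le_one (2 * (a - b) / (a + b))

theorem mixTime_eq_zero {a b : ℝ} (ha : 0 ≤ a) (h : a ≤ b) : mixTime a b = 0 := by
  refine projIcc_of_le_left _ (div_nonpos_of_nonpos_of_nonneg ?_ ?_) <;> linarith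

theorem mixTime_eq_one {a b : ℝ} (ha : 0 < a) (hb : 0 ≤ b) (h : 3 * b ≤ a) : mixTime a b = 1 := by
  refine projIcc_of_right_le _ ?_
  rw [le_div_iff₀ (by linarith)]
  linarith

theorem ContinuousAt.mixTime {E : Type*} [TopologicalSpace E] {a b : E → ℝ} {e : E}
    (ha : ContinuousAt a e) (hb : ContinuousAt b e) (h : a e + b e ≠ 0) :
    ContinuousAt (fun x => _root_.mixTime (a x) (b x)) e :=
  continuous_projIcc.continuousAt.comp
    ((continuousAt_const.mul (ha.sub hb)).div (ha.add hb) h)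

section Gluing

variable {ι G E N T : Type*} [Group G] [TopologicalSpace G]
  [TopologicalSpace E] [MulAction G E] [TopologicalSpace N] [MulAction G N]
  (C : TrivialCover ι G E) (D : C(N × I, N))

namespace TrivialCover

/-- One step of the gluing at the point `e`. The state consists of a point of `N` and the largest
weight seen so far. The contraction `D`, carried over to the chart `i`, is applied to the point, for
a time that depends on the new and the old weight. -/
noncomputable def glueStep (e : E) (z : N × ℝ) (i : ι) : N × ℝ :=
  (C.coord i e • D ((C.coord i e)⁻¹ • z.1, mixTime (C.weight i e) z.2), max z.2 (C.weight i e))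

/-- The steps of the gluing for a list of charts. -/
noncomputable def glueList (start : E → N) (v : E → ℝ) (l : List ι) (e : E) : N × ℝ :=
  l.foldl (C.glueStep D e) (start e, v e)

variable {C D}

theorem glueStep_of_le (hD0 : ∀ w, D (w, 0) = w) {e : E} {z : N × ℝ} {i : ι}
    (h : C.weight i e ≤ z.2) : C.glueStep D e z i = z := by
  refine Prod.ext ?_ (max_eq_left h)
  simp [glueStep, mixTime_eq_zero (C.weight_nonneg i e) h, hD0]

theorem glueList_append (start : E → N) (v : E → ℝ) (l : List ι) (i : ι) (e : E) :
    C.glueList D start v (l ++ [i]) e = C.glueStep D e (C.glueList D start v l e) i := by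
  simp [glueList]

theorem le_glueList (start : E → N) (v : E → ℝ) (l : List ι) (e : E) :
    v e ≤ (C.glueList D start v l e).2 := by
  induction l using List.reverseRecOn with
  | nil => exact le_rfl
  | append_singleton l i ih =>
    rw [glueList_append]
    exact ih.trans (le_max_left _ _)

theorem weight_le_glueList (start : E → N) (v : E → ℝ) (l : List ι) (e : E) {i : ι} (hi : i ∈ l) :
    C.weight i e ≤ (C.glueList D start v l e).2 := by
  induction l using List.reverseRecOn with
  | nil => simp at hi
  | append_singleton l j ih =>
    rw [glueList_append]
    rcases List.mem_append.1 hi with h | h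
    · exact (ih h).trans (le_max_left _ _)
    · rw [List.mem_singleton.1 h]
      exact le_max_right _ _

/-- Charts in which a point has weight zero do not change the gluing at this point. -/
theorem glueList_filter (hD0 : ∀ w, D (w, 0) = w) (start : E → N) {v : E → ℝ} (hv : ∀ e, 0 ≤ v e)
    (l : List ι) (e : E) (p : ι → Bool) (hp : ∀ i, p i = false → C.weight i e = 0) :
    C.glueList D start v (l.filter p) e = C.glueList D start v l e := by
  induction l using List.reverseRecOn with
  | nil => rfl
  | append_singleton l i ih =>
    rw [List.filter_append, glueList_append, ← ih]
    by_cases h : p i = true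
    · rw [List.filter_cons_of_pos h, List.filter_nil, glueList_append]
    · have h' : p i = false := by simpa using h
      rw [List.filter_cons_of_neg h, List.filter_nil, List.append_nil, glueStep_of_le hD0]
      rw [hp i h']
      exact (hv e).trans (le_glueList _ _ _ _)

theorem glueList_of_eq_one (hD0 : ∀ w, D (w, 0) = w) (start : E → N) {v : E → ℝ} (l : List ι)
    {e : E} (h : v e = 1) : (C.glueList D start v l e).1 = start e := by
  induction l using List.reverseRecOn with
  | nil => rfl
  | append_singleton l i ih =>
    rw [glueList_append, glueStep_of_le hD0, ih]
    exact (C.weight_le_one i e).trans (h ▸ le_glueList _ _ _ _)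

theorem continuous_glueList_snd (start : E → N) {v : E → ℝ} (hv : Continuous v) (l : List ι) :
    Continuous fun e => (C.glueList D start v l e).2 := by
  induction l using List.reverseRecOn with
  | nil => exact hv
  | append_singleton l i ih =>
    simp only [glueList_append]
    exact ih.max (C.continuous_weight i)

theorem glueList_snd_smul (start : E → N) {v : E → ℝ} (hv : ∀ (g : G) e, v (g • e) = v e)
    (l : List ι) (g : G) (e : E) :
    (C.glueList D start v l (g • e)).2 = (C.glueList D start v l e).2 := by
  induction l using List.reverseRecOn with
  | nil => exact hv g e
  | append_singleton l i ih =>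
    simp only [glueList_append]
    change max _ _ = max _ _
    rw [ih, C.weight_smul]

section Contraction

variable {r : N → T} (hr : ∀ (g : G) w, r (g • w) = r w) (hDr : ∀ w t, r (D (w, t)) = r w)
  {f : E → T} {start : E → N} {v : E → ℝ} (hstart : ∀ e, r (start e) = f e)

include hr hDr hstart

theorem glueList_over (l : List ι) (e : E) : r (C.glueList D start v l e).1 = f e := by
  induction l using List.reverseRecOn with
  | nil => exact hstart e
  | append_singleton l i ih =>
    rw [glueList_append, glueStep, hr, hDr, hr, ih]

variable [TopologicalSpace T] {k : C(T, N)} (hD0 : ∀ w, D (w, 0) = w)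
  (hD1 : ∀ w, D (w, 1) = k (r w))

include hD1

/-- Where the old weight is small compared with the new one, the old point is forgotten. -/
theorem glueList_append_of_small (l : List ι) {i : ι} {e : E} (hi : 0 < C.weight i e)
    (h0 : 0 ≤ (C.glueList D start v l e).2)
    (h : 3 * (C.glueList D start v l e).2 ≤ C.weight i e) :
    (C.glueList D start v (l ++ [i]) e).1 = C.coord i e • k (f e) := by
  rw [glueList_append, glueStep, mixTime_eq_one hi h0 h, hD1, hr, glueList_over hr hDr hstart]

include hD0

/-- Where some weight is positive, the gluing is equivariant: the old point either has a positive
weight already, or it is forgotten. -/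
theorem glueList_smul (hv : ∀ e, 0 ≤ v e) (hvG : ∀ (g : G) e, v (g • e) = v e)
    (hf : ∀ (g : G) e, f (g • e) = f e)
    (hstartG : ∀ (g : G) e, 0 < v e → start (g • e) = g • start e) (l : List ι) (g : G) (e : E)
    (h : 0 < (C.glueList D start v l e).2) :
    (C.glueList D start v l (g • e)).1 = g • (C.glueList D start v l e).1 := by
  have h0 : ∀ l e, 0 ≤ (C.glueList D start v l e).2 :=
    fun l e => (hv e).trans (le_glueList _ _ _ _)
  induction l using List.reverseRecOn with
  | nil => exact hstartG g e h
  | append_singleton l i ih =>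
    rcases (C.weight_nonneg i e).eq_or_lt with hi | hi
    · rw [glueList_append, glueList_append, glueStep_of_le hD0, glueStep_of_le hD0, ih]
      · rw [glueList_append, glueStep, ← hi] at h
        simpa [h0] using h
      · rw [← hi]; exact h0 _ _
      · rw [C.weight_smul, ← hi]; exact h0 _ _
    · rcases (h0 l e).eq_or_lt with hl | hl
      · rw [glueList_append_of_small hr hDr hstart hD1 l (e := g • e),
          glueList_append_of_small hr hDr hstart hD1 l (e := e), hf,
          C.coord_smul i g e hi, mul_smul]
        · exact hi
        · exact h0 _ _
        · rw [← hl]; simpa using hi.le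
        · rwa [C.weight_smul]
        · exact h0 _ _
        · rw [glueList_snd_smul _ hvG, ← hl, C.weight_smul]; simpa using hi.le
      · simp only [glueList_append, glueStep]
        rw [ih hl, C.coord_smul i g e hi, C.weight_smul, glueList_snd_smul _ hvG, mul_smul]
        congr 3
        rw [smul_smul, mul_inv_rev, mul_assoc, inv_mul_cancel, mul_one]

/-- Where some weight is positive, the gluing is continuous. The new chart, whose `coord i` need
not be continuous outside of `{weight i > 0}`, is not used near points of weight zero, and the old point,
which need not depend continuously on `e` where the old weights vanish, is forgotten near there. -/
theorem continuousAt_glueList [IsTopologicalGroup G] [ContinuousSMul G N] (hv : Continuous v)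
    (hv0 : ∀ e, 0 ≤ v e) (hf : Continuous f)
    (hstartC : ∀ e, 0 < v e → ContinuousAt start e) (l : List ι) (e : E)
    (h : 0 < (C.glueList D start v l e).2) :
    ContinuousAt (fun e => (C.glueList D start v l e).1) e := by
  have h0 : ∀ l e, 0 ≤ (C.glueList D start v l e).2 :=
    fun l e => (hv0 e).trans (le_glueList _ _ _ _)
  induction l using List.reverseRecOn with
  | nil => exact hstartC e h
  | append_singleton l i ih =>
    have hc := continuous_glueList_snd (C := C) (D := D) start hv l
    rcases (C.weight_nonneg i e).eq_or_lt with hi | hi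
    · have hl : 0 < (C.glueList D start v l e).2 := by
        rw [glueList_append, glueStep, ← hi] at h
        simpa [h0] using h
      refine (ih hl).congr ?_
      filter_upwards [(C.continuous_weight i).continuousAt.eventually_lt hc.continuousAt
        (hi ▸ hl)] with x hx
      rw [glueList_append, glueStep_of_le hD0 hx.le]
    · have hcoord := C.continuousAt_coord i e hi
      rcases (h0 l e).eq_or_lt with hl | hl
      · refine ContinuousAt.congr (f := fun x => C.coord i x • k (f x)) ?_ ?_
        · exact hcoord.smul (k.continuous.comp hf).continuousAt
        · filter_upwards [((continuous_const.mul hc).continuousAt (x := e)).eventually_lt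
            (C.continuous_weight i).continuousAt (f := fun x => 3 * (C.glueList D start v l x).2)
            (by rw [← hl]; simpa using hi)] with x hx
          rw [glueList_append_of_small hr hDr hstart hD1 l _ (h0 _ _) hx.le]
          linarith [h0 l x]
      · simp only [glueList_append, glueStep]
        refine hcoord.smul (D.continuous.continuousAt.comp
          (ContinuousAt.prodMk (hcoord.inv.smul (ih hl)) ?_))
        exact (C.continuous_weight i).continuousAt.mixTime hc.continuousAt (by positivity)

include C in
/-- **Gluing of equivariant lifts.** Let `r : N → T` be an invariant map of a `G`-space which
contracts (not equivariantly) over `T` onto a section. Over a `G`-space with a numerable cover by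
trivial pieces, every invariant map `f` to `T` has an equivariant lift to `N`. It can be chosen to
agree on the set `{v = 1}` with a lift that is given on the open set `{v > 0}`. -/
theorem exists_equivariant_lift [IsTopologicalGroup G] [ContinuousSMul G N]
    (hv : Continuous v) (hv0 : ∀ e, 0 ≤ v e)
    (hvG : ∀ (g : G) e, v (g • e) = v e) (hf : Continuous f) (hfG : ∀ (g : G) e, f (g • e) = f e)
    (hstartC : ∀ e, 0 < v e → ContinuousAt start e)
    (hstartG : ∀ (g : G) e, 0 < v e → start (g • e) = g • start e) :
    ∃ w : C(E, N), (∀ (g : G) e, w (g • e) = g • w e) ∧ (∀ e, r (w e) = f e) ∧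
      ∀ e, v e = 1 → w e = start e := by
  classical
  let _ : LinearOrder ι := IsWellOrder.linearOrder WellOrderingRel
  -- the finite set of charts around a point, and the gluing along it
  let F : E → Finset ι := fun e => (C.locallyFinite.point_finite e).toFinset
  have hF : ∀ e i, i ∈ F e ↔ C.weight i e ≠ 0 := fun e i => by simp [F]
  let W : E → N := fun e => (C.glueList D start v (F e).sort e).1
  -- any larger finite set of charts gives the same point
  have key : ∀ (S : Finset ι) e, F e ⊆ S → C.glueList D start v S.sort e =
      C.glueList D start v (F e).sort e := by
    intro S e hS
    rw [← glueList_filter (C := C) hD0 start hv0 (S.sort (· ≤ ·)) e (fun i => decide (i ∈ F e)) (by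
      intro i hi
      by_contra hne
      simp [(hF e i).2 hne] at hi)]
    congr 1
    have h1 : (S.sort.filter fun i => decide (i ∈ F e)).toFinset = F e := by
      ext i
      simp only [List.mem_toFinset, List.mem_filter, Finset.mem_sort, decide_eq_true_eq]
      exact ⟨fun h => h.2, fun h => ⟨hS h, h⟩⟩
    have h2 := (List.toFinset_sort (r := (· ≤ ·)) ((Finset.sort_nodup S (· ≤ ·)).filter
      fun i => decide (i ∈ F e))).2 ((Finset.pairwise_sort S (· ≤ ·)).filter _)
    rw [h1] at h2
    exact h2.symm
  have pos : ∀ (S : Finset ι) e, F e ⊆ S → 0 < (C.glueList D start v S.sort e).2 := by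
    intro S e hS
    obtain ⟨i, hi⟩ := C.exists_pos e
    exact hi.trans_le (weight_le_glueList _ _ _ _
      ((Finset.mem_sort _).2 (hS ((hF e i).2 hi.ne'))))
  have hWc : Continuous W := by
    rw [continuous_iff_continuousAt]
    intro e
    obtain ⟨U, hU, hfin⟩ := C.locallyFinite e
    have hsub : ∀ x ∈ U, F x ⊆ hfin.toFinset := by
      intro x hx i hi
      exact hfin.mem_toFinset.2 ⟨x, (hF x i).1 hi, hx⟩
    refine (continuousAt_glueList hr hDr hstart hD0 hD1 hv hv0 hf hstartC hfin.toFinset.sort e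
      (pos _ _ (hsub e (mem_of_mem_nhds hU)))).congr ?_
    filter_upwards [hU] with x hx
    exact congrArg Prod.fst (key _ _ (hsub x hx))
  refine ⟨⟨W, hWc⟩, fun g e => ?_, fun e => glueList_over hr hDr hstart _ _,
    fun e he => glueList_of_eq_one hD0 _ _ he⟩
  have hFg : F (g • e) = F e := by
    ext i
    rw [hF, hF, C.weight_smul]
  change (C.glueList D start v (F (g • e)).sort (g • e)).1 =
    g • (C.glueList D start v (F e).sort e).1
  rw [hFg]
  exact glueList_smul hr hDr hstart hD0 hD1 hv0 hvG hfG hstartG _ g e (pos _ _ subset_rfl)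

end Contraction

end TrivialCover

end Gluing

/-! ### Equivariant maps into the source of an invariant homotopy equivalence -/

section EquivariantLifting

variable {ι G E P T : Type*} [Group G] [TopologicalSpace G]
  [TopologicalSpace E] [MulAction G E] [TopologicalSpace P] [MulAction G P] [ContinuousSMul G P]
  [TopologicalSpace T]

/-- The action of `G` on the mapping path space of an invariant map. -/
abbrev MapPath.mulAction (d : C(P, T)) (hd : ∀ (g : G) x, d (g • x) = d x) :
    MulAction G (MapPath d) where
  smul g w := ⟨(g • w.1.1, w.1.2), w.2.trans (hd g _).symm⟩
  one_smul w := Subtype.ext (Prod.ext (one_smul G w.1.1) rfl)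
  mul_smul g h w := Subtype.ext (Prod.ext (mul_smul g h w.1.1) rfl)

theorem MapPath.continuousSMul (d : C(P, T)) (hd : ∀ (g : G) x, d (g • x) = d x) :
    let _ := MapPath.mulAction d hd
    ContinuousSMul G (MapPath d) := by
  let _ := MapPath.mulAction d hd
  refine ⟨Continuous.subtype_mk (f := fun z : G × MapPath d => (z.1 • z.2.1.1, z.2.1.2)) ?_ _⟩
  fun_prop

/-- The action of `G` on `I × E`, trivial on `I`. -/
abbrev cylinderAction (G E : Type*) [Group G] [MulAction G E] : MulAction G (I × E) where
  smul g z := (z.1, g • z.2)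
  one_smul z := Prod.ext rfl (one_smul G z.2)
  mul_smul g h z := Prod.ext rfl (mul_smul g h z.2)

/-- The cover of the cylinder `I × E` that is pulled back from a cover of `E`. -/
def TrivialCover.cylinder (C : TrivialCover ι G E) :
    let _ := cylinderAction G E
    TrivialCover ι G (I × E) :=
  let _ := cylinderAction G E
  { weight := fun i z => C.weight i z.2
    continuous_weight := fun i => (C.continuous_weight i).comp continuous_snd
    weight_nonneg := fun i z => C.weight_nonneg i z.2
    weight_le_one := fun i z => C.weight_le_one i z.2
    locallyFinite := C.locallyFinite.preimage_continuous continuous_snd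
    exists_pos := fun z => C.exists_pos z.2
    weight_smul := fun i g z => C.weight_smul i g z.2
    coord := fun i z => C.coord i z.2
    continuousAt_coord := fun i z h => (C.continuousAt_coord i z.2 h).comp continuousAt_snd
    coord_smul := fun i g z h => C.coord_smul i g z.2 h }

variable [IsTopologicalGroup G] (C : TrivialCover ι G E) (d : C(P, T))
  (hd : ∀ (g : G) x, d (g • x) = d x)
  (h : ∃ h : ContinuousMap.HomotopyEquiv P T, h.toFun = d)

include C hd h

/-- Up to invariant homotopy, every invariant map lifts to an equivariant map along an invariant
homotopy equivalence. -/
theorem exists_equivariant_lift_of_homotopyEquiv (f : C(E, T)) (hf : ∀ (g : G) e, f (g • e) = f e) :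
    ∃ (α : C(E, P)) (H : C(I × E, T)), (∀ (g : G) e, α (g • e) = g • α e) ∧
      (∀ e, H (0, e) = d (α e)) ∧ (∀ e, H (1, e) = f e) ∧
      ∀ t (g : G) e, H (t, g • e) = H (t, e) := by
  obtain ⟨h, hh⟩ := h
  obtain ⟨k, D, hk, hD0, hD1, hDr⟩ := exists_vertical_contraction h d hh
  let _ := MapPath.mulAction d hd
  have _ := MapPath.continuousSMul d hd
  obtain ⟨w, hwG, hwr, -⟩ := C.exists_equivariant_lift (D := D) (r := MapPath.last d) (k := k)
    (f := f) (start := fun e => k (f e)) (v := fun _ => 0) (fun _ _ => rfl) hDr (fun _ => hk _)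
    hD0 hD1 continuous_const (fun _ => le_rfl) (fun _ _ => rfl) f.continuous hf
    (fun _ h => absurd h (lt_irrefl _)) (fun _ _ h => absurd h (lt_irrefl _))
  refine ⟨⟨fun e => (w e).1.1, by fun_prop⟩, ⟨fun z => (w z.2).1.2 z.1, by fun_prop⟩,
    fun g e => ?_, fun e => (w e).2, hwr, fun t g e => ?_⟩
  · change (w (g • e)).1.1 = _
    rw [hwG]
    rfl
  · change (w (g • e)).1.2 t = _
    rw [hwG]
    rfl

/-- Equivariant maps are equivariantly homotopic if their images under an invariant homotopy
equivalence are invariantly homotopic. -/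
theorem exists_equivariant_homotopy (α₀ α₁ : C(E, P)) (hα₀ : ∀ (g : G) e, α₀ (g • e) = g • α₀ e)
    (hα₁ : ∀ (g : G) e, α₁ (g • e) = g • α₁ e) (H : C(I × E, T)) (H0 : ∀ e, H (0, e) = d (α₀ e))
    (H1 : ∀ e, H (1, e) = d (α₁ e)) (HG : ∀ t (g : G) e, H (t, g • e) = H (t, e)) :
    ∃ A : C(I × E, P), (∀ e, A (0, e) = α₀ e) ∧ (∀ e, A (1, e) = α₁ e) ∧
      ∀ t (g : G) e, A (t, g • e) = g • A (t, e) := by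
  obtain ⟨h, hh⟩ := h
  obtain ⟨k, D, hk, hD0, hD1, hDr⟩ := exists_vertical_contraction h d hh
  let _ := MapPath.mulAction d hd
  have _ := MapPath.continuousSMul d hd
  let _ := cylinderAction G E
  -- the homotopy is made constant near both ends, where the lifts are prescribed
  let θ : ℝ → I := fun t => projIcc 0 1 zero_le_one (3 * t - 1)
  have hθ : Continuous θ := continuous_projIcc.comp (by fun_prop)
  have hθ0 : ∀ t : ℝ, t < 1 / 3 → θ t = 0 := fun t ht => projIcc_of_le_left _ (by linarith)
  have hθ1 : ∀ t : ℝ, 2 / 3 < t → θ t = 1 := fun t ht => projIcc_of_right_le _ (by linarith)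
  let v : I × E → ℝ := fun z => max 0 (max (1 - 3 * (z.1 : ℝ)) (3 * (z.1 : ℝ) - 2))
  let c : C(P, C(I, T)) := ContinuousMap.curry ⟨fun z => d z.1, by fun_prop⟩
  let j : C(P, MapPath d) :=
    { toFun := fun x => ⟨(x, c x), rfl⟩
      continuous_toFun := by fun_prop }
  have hj : ∀ x, MapPath.last d (j x) = d x := fun _ => rfl
  have hjG : ∀ (g : G) x, j (g • x) = g • j x := by
    intro g x
    refine Subtype.ext (Prod.ext rfl ?_)
    ext s
    exact hd g x
  -- the values of `start` in the middle do not matter, except that they lie over the homotopy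
  let start : I × E → MapPath d := fun z =>
    if (z.1 : ℝ) < 1 / 3 then j (α₀ z.2) else
      if 2 / 3 < (z.1 : ℝ) then j (α₁ z.2) else k (H (θ z.1, z.2))
  have hs0 : ∀ z : I × E, (z.1 : ℝ) < 1 / 3 → start z = j (α₀ z.2) := fun z hz => if_pos hz
  have hs1 : ∀ z : I × E, 2 / 3 < (z.1 : ℝ) → start z = j (α₁ z.2) := fun z hz => by
    simp only [start]
    rw [if_neg (by linarith), if_pos hz]
  have hvpos : ∀ z, 0 < v z → (z.1 : ℝ) < 1 / 3 ∨ 2 / 3 < (z.1 : ℝ) := by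
    intro z hz
    rcases lt_max_iff.1 hz with hz | hz
    · exact absurd hz (lt_irrefl _)
    · rcases lt_max_iff.1 hz with hz | hz
      · left; linarith
      · right; linarith
  have hfst : Continuous fun z : I × E => (z.1 : ℝ) := by fun_prop
  obtain ⟨w, hwG, -, hws⟩ := C.cylinder.exists_equivariant_lift (D := D) (r := MapPath.last d)
    (k := k) (f := fun z => H (θ z.1, z.2)) (start := start) (v := v) (fun _ _ => rfl) hDr
    (by
      intro z
      by_cases hz0 : (z.1 : ℝ) < 1 / 3
      · rw [hs0 z hz0, hj, hθ0 _ hz0, H0]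
      · by_cases hz1 : 2 / 3 < (z.1 : ℝ)
        · rw [hs1 z hz1, hj, hθ1 _ hz1, H1]
        · simp only [start]
          rw [if_neg hz0, if_neg hz1, hk])
    hD0 hD1 (by fun_prop) (fun _ => le_max_left _ _) (fun _ _ => rfl) (by fun_prop)
    (fun g z => HG _ g z.2)
    (by
      intro z hz
      rcases hvpos z hz with hz | hz
      · refine ContinuousAt.congr (f := fun z => j (α₀ z.2)) (by fun_prop) ?_
        filter_upwards [hfst.continuousAt.eventually_lt continuousAt_const hz] with x hx
        exact (hs0 x hx).symm
      · refine ContinuousAt.congr (f := fun z => j (α₁ z.2)) (by fun_prop) ?_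
        filter_upwards [continuousAt_const.eventually_lt hfst.continuousAt hz] with x hx
        exact (hs1 x hx).symm)
    (by
      intro g z hz
      rcases hvpos z hz with hz | hz
      · rw [hs0 z hz, hs0 (g • z) hz, ← hjG, ← hα₀]
        rfl
      · rw [hs1 z hz, hs1 (g • z) hz, ← hjG, ← hα₁]
        rfl)
  refine ⟨⟨fun z => (w z).1.1, by fun_prop⟩, fun e => ?_, fun e => ?_, fun t g e => ?_⟩
  · change (w (0, e)).1.1 = _
    rw [hws _ (by norm_num [v]), hs0 _ (by norm_num)]
    rfl
  · change (w (1, e)).1.1 = _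
    rw [hws _ (by norm_num [v]), hs1 _ (by norm_num)]
    rfl
  · change (w (g • (t, e))).1.1 = _
    rw [hwG]
    rfl

end EquivariantLifting

/-! ### The orthogonal actions on the sphere and on its mapping spaces -/

section OrthogonalActions

theorem norm_orth_smul {n : ℕ} (A : OrthGroup n) (x : EucSpace n) : ‖A • x‖ = ‖x‖ := by
  have hA : A.1.transpose * A.1 = 1 := (Matrix.mem_orthogonalGroup_iff' (Fin n) ℝ).1 A.2
  have h : ∀ y : EucSpace n, ‖y‖ ^ 2 = y.ofLp ⬝ᵥ y.ofLp := by
    intro y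
    rw [EuclideanSpace.real_norm_sq_eq]
    exact Finset.sum_congr rfl fun i _ => sq _
  rw [← sq_eq_sq₀ (norm_nonneg _) (norm_nonneg _), h, h, orth_smul_euc]
  change A.1.mulVec x.ofLp ⬝ᵥ A.1.mulVec x.ofLp = _
  rw [Matrix.dotProduct_mulVec, ← Matrix.mulVec_transpose, Matrix.mulVec_mulVec, hA,
    Matrix.one_mulVec]

instance continuousSMul_euc (n : ℕ) : ContinuousSMul (OrthGroup n) (EucSpace n) := by
  refine ⟨?_⟩
  simp only [orth_smul_euc]
  exact (PiLp.continuous_toLp 2 _).comp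
    ((continuous_subtype_val.comp continuous_fst).matrix_mulVec
      ((PiLp.continuous_ofLp 2 _).comp continuous_snd))

theorem orth_smul_infty {n : ℕ} (A : OrthGroup n) :
    A • (OnePoint.infty : PtSphere n) = OnePoint.infty := rfl

instance continuousSMul_sphere (n : ℕ) : ContinuousSMul (OrthGroup n) (PtSphere n) := by
  refine ⟨continuous_iff_continuousAt.2 ?_⟩
  rintro ⟨A, s⟩
  induction s using OnePoint.rec with
  | infty =>
    -- a compact set of `ℝ^n` lies in a ball, and balls are invariant
    refine OnePoint.hasBasis_nhds_infty.tendsto_right_iff.2 ?_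
    rintro K ⟨-, hK⟩
    obtain ⟨R, hR⟩ := hK.isBounded.subset_closedBall 0
    have hball : ∀ᶠ s : PtSphere n in 𝓝 OnePoint.infty,
        s ∈ ((↑) : EucSpace n → PtSphere n) '' (Metric.closedBall 0 R)ᶜ ∪ {OnePoint.infty} :=
      OnePoint.hasBasis_nhds_infty.mem_of_mem
        ⟨Metric.isClosed_closedBall, isCompact_closedBall _ _⟩
    filter_upwards [(continuous_snd.tendsto (A, (OnePoint.infty : PtSphere n))).eventually hball]
    rintro ⟨B, s⟩ (⟨x, hx, rfl⟩ | rfl)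
    · left
      refine ⟨B • x, fun hBx => hx ?_, rfl⟩
      have := hR hBx
      simpa [norm_orth_smul] using this
    · right
      rfl
  | coe x =>
    have h : Filter.Tendsto (fun z : OrthGroup n × EucSpace n => z.1 • (z.2 : PtSphere n))
        (𝓝 (A, x)) (𝓝 (A • (x : PtSphere n))) :=
      (OnePoint.continuous_coe.comp continuous_smul).continuousAt
    change Filter.Tendsto _ _ _
    -- `ℝ^n` is open in the sphere
    rw [nhds_prod_eq, OnePoint.nhds_coe_eq, ← Filter.map_id (f := 𝓝 A), Filter.prod_map_map_eq,
      Filter.tendsto_map'_iff, ← nhds_prod_eq]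
    exact h

theorem continuous_orthIncl (n m : ℕ) : Continuous (orthIncl n m) := by
  refine Continuous.subtype_mk ?_ _
  exact (continuous_subtype_val.matrix_fromBlocks continuous_const continuous_const
    continuous_const).matrix_reindex _ _

variable (Θ : OrthOmegaSpectrum) (n m : ℕ)

/-- The diagonal action `α ↦ a ∘ α ∘ a⁻¹` of `O(n)` on `Hom_*(S^n, Θ_{n+m})`. -/
noncomputable instance conjAction :
    MulAction (OrthGroup n) (PtMaps n (Θ.space (n + m)) (Θ.vac (n + m))) where
  smul a α := ⟨⟨fun s => orthIncl n m a • α.1 (a⁻¹ • s), by fun_prop⟩, by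
    change orthIncl n m a • α.1 (a⁻¹ • OnePoint.infty) = _
    rw [orth_smul_infty, α.2, Θ.smul_vac]⟩
  one_smul α := by
    refine Subtype.ext (ContinuousMap.ext fun s => ?_)
    change orthIncl n m 1 • α.1 ((1 : OrthGroup n)⁻¹ • s) = α.1 s
    simp
  mul_smul a b α := by
    refine Subtype.ext (ContinuousMap.ext fun s => ?_)
    change orthIncl n m (a * b) • α.1 ((a * b)⁻¹ • s) =
      orthIncl n m a • orthIncl n m b • α.1 (b⁻¹ • a⁻¹ • s)
    rw [mul_inv_rev, mul_smul, map_mul, mul_smul]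

variable {Θ n m}

theorem conj_smul_apply (a : OrthGroup n) (α : PtMaps n (Θ.space (n + m)) (Θ.vac (n + m)))
    (s : PtSphere n) : (a • α).1 s = orthIncl n m a • α.1 (a⁻¹ • s) := rfl

instance continuousSMul_conj :
    ContinuousSMul (OrthGroup n) (PtMaps n (Θ.space (n + m)) (Θ.vac (n + m))) := by
  refine ⟨Continuous.subtype_mk (ContinuousMap.continuous_of_continuous_uncurry _ ?_) _⟩
  have h := continuous_orthIncl n m
  change Continuous fun z : (OrthGroup n × PtMaps n (Θ.space (n + m)) (Θ.vac (n + m))) ×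
    PtSphere n => orthIncl n m z.1.1 • z.1.2.1 (z.1.1⁻¹ • z.2)
  fun_prop

theorem deloop_smul (a : OrthGroup n) (α : PtMaps n (Θ.space (n + m)) (Θ.vac (n + m))) :
    Θ.deloop n m (a • α) = Θ.deloop n m α := by
  refine Θ.deloop_invariant n m a _ _ fun s => ?_
  rw [conj_smul_apply, inv_smul_smul]

end OrthogonalActions

/-! ### Universal bundles -/

section UniversalBundle

universe u v

variable {G : Type u} {EG : Type v} [Group G] [MulAction G EG]

theorem toClassSpace_smul (g : G) (e : EG) : toClassSpace G (g • e) = toClassSpace G e :=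
  Quotient.sound (s := MulAction.orbitRel G EG) ⟨g, rfl⟩

theorem continuous_toClassSpace [TopologicalSpace EG] : Continuous (toClassSpace G (EG := EG)) :=
  continuous_quot_mk

variable [TopologicalSpace G] [TopologicalSpace EG]

theorem IsUniversalBundle.exists_trivialCover (h : IsUniversalBundle G EG) :
    ∃ ι : Type v, Nonempty (TrivialCover ι G EG) := by
  classical
  obtain ⟨ι, U, ρ, hU, hρ, htriv⟩ := h.numerable
  choose t ht htG using htriv
  have hc := continuous_toClassSpace (G := G) (EG := EG)
  have hsupp : ∀ i e, 0 < ρ i (toClassSpace G e) → toClassSpace G e ∈ U i := fun i e he =>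
    hρ i (subset_tsupport _ he.ne')
  -- the second coordinate in the trivialization over `U i`
  let c : ι → EG → G := fun i e =>
    if he : toClassSpace G e ∈ U i then ((t i).symm ⟨e, he⟩).2 else 1
  have hcsub : ∀ i (e : toClassSpace G (EG := EG) ⁻¹' U i), c i e = ((t i).symm e).2 :=
    fun i e => dif_pos e.2
  refine ⟨ι, ⟨{
    weight := fun i e => ρ i (toClassSpace G e)
    continuous_weight := fun i => (ρ i).continuous.comp hc
    weight_nonneg := fun i e => ρ.nonneg i _
    weight_le_one := fun i e => ρ.le_one i _
    locallyFinite := ρ.locallyFinite.preimage_continuous hc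
    exists_pos := fun e => ρ.exists_pos (mem_univ _)
    weight_smul := fun i g e => by rw [toClassSpace_smul]
    coord := c
    continuousAt_coord := fun i e he => ?_
    coord_smul := fun i g e he => ?_ }⟩⟩
  · have hopen : IsOpen (toClassSpace G (EG := EG) ⁻¹' U i) := (hU i).preimage hc
    have hon : ContinuousOn (c i) (toClassSpace G (EG := EG) ⁻¹' U i) := by
      rw [continuousOn_iff_continuous_domRestrict]
      refine (continuous_snd.comp (t i).symm.continuous).congr fun x => (hcsub i x).symm
    exact hon.continuousAt (hopen.mem_nhds (hsupp i e he))
  · have he' := hsupp i e he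
    have hge : toClassSpace G (g • e) ∈ U i := by rwa [toClassSpace_smul]
    have h1 : (t i).symm ⟨g • e, hge⟩ =
        (((t i).symm ⟨e, he'⟩).1, g * ((t i).symm ⟨e, he'⟩).2) := by
      rw [Homeomorph.symm_apply_eq]
      apply Subtype.ext
      rw [htG, Prod.mk.eta, Homeomorph.apply_symm_apply]
    rw [hcsub i ⟨g • e, hge⟩, hcsub i ⟨e, he'⟩, h1]

namespace TrivialCover

variable {ι : Type*} (C : TrivialCover ι G EG)

include C

/-- The structure group acts freely. -/
theorem eq_one_of_smul_eq {g : G} {e : EG} (h : g • e = e) : g = 1 := by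
  obtain ⟨i, hi⟩ := C.exists_pos e
  have := C.coord_smul i g e hi
  rw [h] at this
  simpa using this.symm

/-- The translation function of the bundle is continuous: if `e` and `g • e` are close to each
other, then `g` is close to `1`. -/
theorem exists_nhds_translation [IsTopologicalGroup G] (e₀ : EG) {M : Set G} (hM : M ∈ 𝓝 (1 : G)) :
    ∃ V ∈ 𝓝 e₀, ∀ e ∈ V, ∀ g : G, g • e ∈ V → g ∈ M := by
  obtain ⟨i, hi⟩ := C.exists_pos e₀
  have h1 : Filter.Tendsto (fun p : EG × EG => C.coord i p.2 * (C.coord i p.1)⁻¹)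
      (𝓝 e₀ ×ˢ 𝓝 e₀) (𝓝 1) := by
    have hc : Filter.Tendsto (C.coord i) (𝓝 e₀) (𝓝 (C.coord i e₀)) := C.continuousAt_coord i e₀ hi
    have h2 := (hc.comp (Filter.tendsto_snd (f := 𝓝 e₀))).mul
      (hc.comp (Filter.tendsto_fst (g := 𝓝 e₀))).inv
    rwa [mul_inv_cancel] at h2
  obtain ⟨V, hV, hVM⟩ := (Filter.eventually_prod_self_iff
    (r := fun e e' => C.coord i e' * (C.coord i e)⁻¹ ∈ M)).1 (h1.eventually hM)
  refine ⟨V ∩ {e | 0 < C.weight i e}, Filter.inter_mem hV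
    ((C.continuous_weight i).continuousAt.eventually_const_lt hi), ?_⟩
  rintro e ⟨he, hpos⟩ g ⟨hge, -⟩
  have := hVM e he (g • e) hge
  rwa [C.coord_smul i g e hpos, mul_inv_cancel_right] at this

end TrivialCover

end UniversalBundle

/-! ### Frame bundles of homotopy quotients -/

section FrameBundleLemmas

variable {G : Type*} [Group G] {n : ℕ} (φ : G →* OrthGroup n)
  {Y : Type*} [MulAction (OrthGroup n) Y] {EG : Type*} [MulAction G EG]

theorem HQ.mk_smul (g : G) (y : Y) (e : EG) : HQ.mk φ (φ g • y) (g • e) = HQ.mk φ y e :=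
  (Quotient.sound (s := hqSetoid φ Y EG) (a := (y, e)) ⟨g, rfl⟩).symm

theorem HQ.mk_eq_iff (y y' : Y) (e e' : EG) :
    HQ.mk φ y e = HQ.mk φ y' e' ↔ ∃ g : G, φ g • y = y' ∧ g • e = e' := by
  refine (Quotient.eq (r := hqSetoid φ Y EG)).trans ?_
  exact exists_congr fun g => Prod.ext_iff

theorem FrameBundle.mk_smul (g : G) (y : Y) (u : OrthGroup n) (e : EG) :
    FrameBundle.mk φ (φ g • y) (u * (φ g)⁻¹) (g • e) = FrameBundle.mk φ y u e :=
  HQ.mk_smul φ (Y := Frames n Y) g (y, u) e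

theorem FrameBundle.mk_smul' (g : G) (y : Y) (u : OrthGroup n) (e : EG) :
    FrameBundle.mk φ (φ g • y) u (g • e) = FrameBundle.mk φ y (u * φ g) e := by
  rw [← FrameBundle.mk_smul φ g y (u * φ g) e, mul_inv_cancel_right]

variable {φ}

theorem FrameBundle.smul_mk (a : OrthGroup n) (y : Y) (u : OrthGroup n) (e : EG) :
    a • FrameBundle.mk φ y u e = FrameBundle.mk φ y (a * u) e := rfl

theorem FrameBundle.exists_eq_mk (p : FrameBundle φ Y EG) {y : Y} {e : EG}
    (hp : p.proj = HQ.mk φ y e) : ∃ u, p = FrameBundle.mk φ y u e := by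
  obtain ⟨⟨⟨y', u⟩, e'⟩, rfl⟩ := Quotient.exists_rep p
  obtain ⟨g, rfl, rfl⟩ := (HQ.mk_eq_iff φ y' y e' e).1 hp
  exact ⟨_, (FrameBundle.mk_smul φ g y' u e').symm⟩

theorem FrameBundle.mk_injective [TopologicalSpace G] [TopologicalSpace EG] {ι : Type*}
    (C : TrivialCover ι G EG) {y : Y} {u u' : OrthGroup n} {e : EG}
    (h : FrameBundle.mk φ y u e = FrameBundle.mk φ y u' e) : u = u' := by
  obtain ⟨g, h1, h2⟩ := (HQ.mk_eq_iff φ (Y := Frames n Y) (y, u) (y, u') e e).1 h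
  obtain rfl := C.eq_one_of_smul_eq h2
  have h3 : u * (φ 1)⁻¹ = u' := congrArg Prod.snd h1
  simpa using h3

variable [TopologicalSpace Y] [ContinuousConstSMul (OrthGroup n) Y] [TopologicalSpace EG]
  [ContinuousConstSMul G EG]

variable (φ) in
theorem HQ.isOpenQuotientMap_mk :
    IsOpenQuotientMap fun p : Y × EG => HQ.mk φ p.1 p.2 := by
  refine ⟨Quotient.mk_surjective, continuous_quot_mk, fun U hU => ?_⟩
  have hq : IsQuotientMap fun p : Y × EG => HQ.mk φ p.1 p.2 := isQuotientMap_quot_mk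
  rw [← hq.isOpen_preimage]
  have : (fun p : Y × EG => HQ.mk φ p.1 p.2) ⁻¹' ((fun p : Y × EG => HQ.mk φ p.1 p.2) '' U) =
      ⋃ g : G, (fun p : Y × EG => (φ g • p.1, g • p.2)) ⁻¹' U := by
    ext ⟨y, e⟩
    simp only [mem_preimage, mem_image, mem_iUnion, Prod.exists]
    constructor
    · rintro ⟨y', e', hU, h⟩
      obtain ⟨g, rfl, rfl⟩ := (HQ.mk_eq_iff φ _ _ _ _).1 h.symm
      exact ⟨g, hU⟩
    · rintro ⟨g, hg⟩
      exact ⟨_, _, hg, HQ.mk_smul φ g y e⟩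
  rw [this]
  exact isOpen_iUnion fun g => hU.preimage (by fun_prop)

instance : ContinuousConstSMul (OrthGroup n) (Frames n Y) := by
  refine ⟨fun A => ?_⟩
  change Continuous fun p : Y × OrthGroup n => (A • p.1, p.2 * A⁻¹)
  fun_prop

variable (φ) in
theorem FrameBundle.isOpenQuotientMap_mk :
    IsOpenQuotientMap fun p : (Y × OrthGroup n) × EG => FrameBundle.mk φ p.1.1 p.1.2 p.2 :=
  HQ.isOpenQuotientMap_mk φ (Y := Frames n Y)

end FrameBundleLemmas

/-! ### Sections of the state bundle as equivariant maps -/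

section States

variable {Θ : OrthOmegaSpectrum} {G : Type*} [Group G] {n m : ℕ} {φ : G →* OrthGroup n}
  {Y : Type*} [MulAction (OrthGroup n) Y] {EG : Type*} [MulAction G EG]

/-- The state bundle over the homotopy quotient `Y // G`. -/
abbrev StateHQ (Θ : OrthOmegaSpectrum) (m : ℕ) (φ : G →* OrthGroup n) (Y : Type*)
    [MulAction (OrthGroup n) Y] (EG : Type*) [MulAction G EG] : Type _ :=
  StateBundle Θ n m (FrameBundle.proj (φ := φ) (Y := Y) (EG := EG))

/-- A state is determined by its value in one frame. -/
theorem StateHQ.ext_of_frame {z z' : StateHQ Θ m φ Y EG} {y : Y} {u : OrthGroup n} {e : EG}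
    (h : HQ.mk φ y e = z.1) (h' : HQ.mk φ y e = z'.1)
    (hval : z.2.val ⟨FrameBundle.mk φ y u e, h⟩ = z'.2.val ⟨FrameBundle.mk φ y u e, h'⟩) :
    z = z' := by
  obtain ⟨b, τ⟩ := z
  obtain ⟨b', τ'⟩ := z'
  dsimp only at h h'
  subst h
  subst h'
  have key : τ.val = τ'.val := by
    funext p
    obtain ⟨u', hp⟩ := FrameBundle.exists_eq_mk p.1 p.2
    have hp' : p.1 = (u' * u⁻¹) • FrameBundle.mk φ y u e := by
      rw [hp, FrameBundle.smul_mk, inv_mul_cancel_right]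
    rw [τ.equivariant (u' * u⁻¹) ⟨FrameBundle.mk φ y u e, rfl⟩ p hp',
      τ'.equivariant (u' * u⁻¹) ⟨FrameBundle.mk φ y u e, rfl⟩ p hp', hval]
  obtain ⟨τ, _⟩ := τ
  obtain rfl : τ = τ'.val := key
  rfl

variable [TopologicalSpace G] [TopologicalSpace EG] {ι : Type*} (C : TrivialCover ι G EG)

/-- The state over `[y, e]` with the value `θ` in the frame `[y, u, e]`. Every frame over `[y, e]`
is `[y, u', e]` for some `u'`, unique as `G` acts freely on `EG`, and the value in it is
`(u' u⁻¹) θ`. -/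
noncomputable def stateAt (y : Y) (u : OrthGroup n) (e : EG) (θ : Θ.space (n + m)) :
    StateHQ Θ m φ Y EG :=
  ⟨HQ.mk φ y e,
    { val := fun p => orthIncl n m ((FrameBundle.exists_eq_mk p.1 p.2).choose * u⁻¹) • θ
      equivariant := by
        intro a p q hpq
        have hp := (FrameBundle.exists_eq_mk p.1 p.2).choose_spec
        have hq := (FrameBundle.exists_eq_mk q.1 q.2).choose_spec
        have h := (hq.symm.trans hpq).trans (congrArg (a • ·) hp)
        rw [FrameBundle.mk_injective C h, mul_assoc, map_mul, mul_smul] }⟩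

theorem stateAt_val (y : Y) (u u' : OrthGroup n) (e : EG) (θ : Θ.space (n + m)) :
    (stateAt (φ := φ) C y u e θ).2.val ⟨FrameBundle.mk φ y u' e, rfl⟩ =
      orthIncl n m (u' * u⁻¹) • θ := by
  have h := (FrameBundle.exists_eq_mk (FrameBundle.mk φ y u' e) (y := y) (e := e) rfl).choose_spec
  change orthIncl n m (_ * u⁻¹) • θ = _
  rw [← FrameBundle.mk_injective C h]

theorem eq_stateAt {z : StateHQ Θ m φ Y EG} {y : Y} {u : OrthGroup n} {e : EG}
    (h : HQ.mk φ y e = z.1) : z = stateAt C y u e (z.2.val ⟨FrameBundle.mk φ y u e, h⟩) := by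
  refine StateHQ.ext_of_frame (y := y) (u := u) (e := e) h rfl ?_
  rw [stateAt_val, mul_inv_cancel, map_one, one_smul]

/-- The same state is described by different frames. -/
theorem stateAt_smul (a : OrthGroup n) (y : Y) (u : OrthGroup n) (e : EG) (θ : Θ.space (n + m)) :
    stateAt (φ := φ) C y (a * u) e (orthIncl n m a • θ) = stateAt C y u e θ := by
  rw [eq_stateAt C (z := stateAt C y u e θ) (y := y) (u := a * u) (e := e) rfl, stateAt_val,
    mul_inv_cancel_right]

/-- The value of a state at a translated point: the frame changes by the translation. -/
theorem exists_stateAt_val {z : StateHQ Θ m φ Y EG} {y y' : Y} {u : OrthGroup n} {e e' : EG}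
    {θ : Θ.space (n + m)} (hz : stateAt C y' u e' θ = z) (hb : HQ.mk φ y e = z.1) :
    ∃ g : G, g • e' = e ∧
      z.2.val ⟨FrameBundle.mk φ y 1 e, hb⟩ = orthIncl n m (φ g * u⁻¹) • θ := by
  subst hz
  obtain ⟨g, rfl, rfl⟩ := (HQ.mk_eq_iff φ y' y e' e).1 hb.symm
  refine ⟨g, rfl, ?_⟩
  have hval : ∀ (p : FrameBundle φ Y EG) (_ : p = FrameBundle.mk φ y' (φ g) e')
      (hp : p.proj = HQ.mk φ y' e'),
      (stateAt C y' u e' θ).2.val ⟨p, hp⟩ = orthIncl n m (φ g * u⁻¹) • θ := by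
    rintro p rfl hp
    exact stateAt_val C y' u (φ g) e' θ
  exact hval (FrameBundle.mk φ (φ g • y') 1 (g • e'))
    (by rw [FrameBundle.mk_smul', one_mul]) hb

variable [TopologicalSpace Y]

theorem continuous_stateAt :
    Continuous fun x : ((Y × OrthGroup n) × EG) × Θ.space (n + m) =>
      stateAt (φ := φ) C x.1.1.1 x.1.1.2 x.1.2 x.2 := by
  let z : ((Y × OrthGroup n) × EG) × Θ.space (n + m) →
      StatePullback Θ n m (FrameBundle.proj (φ := φ) (Y := Y) (EG := EG)) := fun x =>
    ⟨(FrameBundle.mk φ x.1.1.1 x.1.1.2 x.1.2, stateAt C x.1.1.1 x.1.1.2 x.1.2 x.2), rfl⟩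
  have hz : Continuous z := by
    rw [continuous_induced_rng]
    have h : (StatePullback.triv Θ n m (FrameBundle.proj (φ := φ) (Y := Y) (EG := EG))) ∘ z =
        fun x => (FrameBundle.mk φ x.1.1.1 x.1.1.2 x.1.2, x.2) := by
      funext x
      refine Prod.ext rfl ?_
      change (stateAt C x.1.1.1 x.1.1.2 x.1.2 x.2).2.val ⟨_, _⟩ = _
      rw [stateAt_val, mul_inv_cancel, map_one, one_smul]
    rw [h]
    have hmk : Continuous fun p : (Y × OrthGroup n) × EG =>
      FrameBundle.mk φ p.1.1 p.1.2 p.2 := continuous_quot_mk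
    exact (hmk.comp continuous_fst).prodMk continuous_snd
  have hc : Continuous (fun w : StatePullback Θ n m
      (FrameBundle.proj (φ := φ) (Y := Y) (EG := EG)) => w.1.2) := continuous_coinduced_rng
  exact hc.comp hz

variable [ContinuousConstSMul (OrthGroup n) Y] [ContinuousConstSMul G EG]

/-- Pulled back to the frame bundle, the image of an open set under `stateAt` is the image of the
union of its translates under `O(n)`. -/
theorem isOpenMap_stateAt :
    IsOpenMap fun x : ((Y × OrthGroup n) × EG) × Θ.space (n + m) =>
      stateAt (φ := φ) C x.1.1.1 x.1.1.2 x.1.2 x.2 := by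
  intro U hU
  refine isOpen_coinduced.2 (isOpen_induced_iff.2 ?_)
  let U' : Set (((Y × OrthGroup n) × EG) × Θ.space (n + m)) :=
    ⋃ a : OrthGroup n, (fun x => (((x.1.1.1, a * x.1.1.2), x.1.2), orthIncl n m a • x.2)) ⁻¹' U
  have hU' : IsOpen U' := isOpen_iUnion fun a => hU.preimage (by fun_prop)
  refine ⟨Prod.map (fun p : (Y × OrthGroup n) × EG => FrameBundle.mk φ p.1.1 p.1.2 p.2) id '' U',
    ((FrameBundle.isOpenQuotientMap_mk φ).prodMap IsOpenQuotientMap.id).isOpenMap _ hU', ?_⟩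
  ext w
  simp only [mem_preimage, mem_image]
  constructor
  · rintro ⟨x, hx, hw⟩
    obtain ⟨a, ha⟩ := mem_iUnion.1 hx
    refine ⟨_, ha, ?_⟩
    dsimp only
    rw [stateAt_smul]
    obtain ⟨⟨p, z⟩, hz⟩ := w
    obtain rfl : FrameBundle.mk φ x.1.1.1 x.1.1.2 x.1.2 = p := congrArg Prod.fst hw
    have h2 : x.2 = z.2.val ⟨_, hz⟩ := congrArg Prod.snd hw
    rw [h2]
    exact (eq_stateAt C hz).symm
  · rintro ⟨⟨⟨⟨y, u⟩, e⟩, θ⟩, hx, hw⟩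
    obtain ⟨⟨p, z⟩, hz⟩ := w
    dsimp only at hw hz
    subst hw
    obtain ⟨u', rfl⟩ := FrameBundle.exists_eq_mk p hz
    refine ⟨(((y, u'), e), orthIncl n m (u' * u⁻¹) • θ), mem_iUnion.2 ⟨u * u'⁻¹, ?_⟩, ?_⟩
    · rw [mem_preimage]
      dsimp only
      rw [inv_mul_cancel_right, ← mul_smul, ← map_mul]
      simpa using hx
    · exact Prod.ext rfl (stateAt_val C y u u' e θ).symm

/-- States near a given one have values near the given value, in a frame near the given frame. -/
theorem eventually_eq_stateAt (y₀ : Y) (e₀ : EG) (θ₀ : Θ.space (n + m)) {N : Set (OrthGroup n)}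
    (hN : N ∈ 𝓝 1) {E' : Set EG} (hE' : E' ∈ 𝓝 e₀) {V : Set (Θ.space (n + m))} (hV : V ∈ 𝓝 θ₀) :
    ∀ᶠ z in 𝓝 (stateAt (φ := φ) C y₀ 1 e₀ θ₀), ∃ y u e θ, u ∈ N ∧ e ∈ E' ∧ θ ∈ V ∧
      stateAt (φ := φ) C y u e θ = z := by
  have hU : ∀ᶠ x : ((Y × OrthGroup n) × EG) × Θ.space (n + m) in 𝓝 (((y₀, 1), e₀), θ₀),
      x.1.1.2 ∈ N ∧ x.1.2 ∈ E' ∧ x.2 ∈ V := by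
    refine Filter.Eventually.and ?_ (Filter.Eventually.and ?_ ?_)
    · exact (show Continuous fun x : ((Y × OrthGroup n) × EG) × Θ.space (n + m) => x.1.1.2 by
        fun_prop).continuousAt hN
    · exact (show Continuous fun x : ((Y × OrthGroup n) × EG) × Θ.space (n + m) => x.1.2 by
        fun_prop).continuousAt hE'
    · exact continuous_snd.continuousAt hV
  filter_upwards [(isOpenMap_stateAt (φ := φ) C).image_mem_nhds hU]
  rintro z ⟨x, ⟨h1, h2, h3⟩, rfl⟩
  exact ⟨_, _, _, _, h1, h2, h3, rfl⟩

include C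

/-- The value of a state in the standard frame depends continuously on the state and the base
point. This rests on the continuity of the translation function of `EG`. -/
theorem continuous_state_val [IsTopologicalGroup G] (hφ : Continuous φ) {Z : Type*}
    [TopologicalSpace Z] {j : Z → StateHQ Θ m φ Y EG} (hj : Continuous j) {y : Z → Y}
    {e : Z → EG} (he : Continuous e) (hb : ∀ z, HQ.mk φ (y z) (e z) = (j z).1) :
    Continuous fun z => (j z).2.val ⟨FrameBundle.mk φ (y z) 1 (e z), hb z⟩ := by
  refine continuous_iff_continuousAt.2 fun z₀ => ?_
  set θ₀ := (j z₀).2.val ⟨FrameBundle.mk φ (y z₀) 1 (e z₀), hb z₀⟩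
  intro V hV
  have hm : Filter.Tendsto (fun x : G × OrthGroup n × Θ.space (n + m) =>
      orthIncl n m (φ x.1 * x.2.1⁻¹) • x.2.2) (𝓝 1 ×ˢ 𝓝 1 ×ˢ 𝓝 θ₀) (𝓝 θ₀) := by
    have hc : Continuous fun x : G × OrthGroup n × Θ.space (n + m) =>
        orthIncl n m (φ x.1 * x.2.1⁻¹) • x.2.2 := by
      have := continuous_orthIncl n m
      fun_prop
    have := hc.tendsto (1, 1, θ₀)
    simpa [nhds_prod_eq] using this
  obtain ⟨M, hM, W, hW, hMW⟩ := Filter.mem_prod_iff.1 (hm hV)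
  obtain ⟨N, hN, V', hV', hNV⟩ := Filter.mem_prod_iff.1 hW
  have hMV : ∀ g ∈ M, ∀ u ∈ N, ∀ θ ∈ V', orthIncl n m (φ g * u⁻¹) • θ ∈ V :=
    fun g hg u hu θ hθ => @hMW (g, u, θ) (mk_mem_prod hg (hNV (mk_mem_prod hu hθ)))
  obtain ⟨E', hE', htrans⟩ := C.exists_nhds_translation (e z₀) hM
  have hnear := eventually_eq_stateAt C (y z₀) (e z₀) θ₀ (φ := φ) hN hE' hV'
  rw [← eq_stateAt C (hb z₀)] at hnear
  rw [Filter.mem_map]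
  filter_upwards [hj.continuousAt.eventually hnear, he.continuousAt.preimage_mem_nhds hE']
    with z hz hez
  obtain ⟨y', u', e', θ', hu', he', hθ', hx⟩ := hz
  obtain ⟨g, hg, hval⟩ := exists_stateAt_val C hx (hb z)
  have hgM : g ∈ M := htrans e' he' g (hg ▸ hez)
  change (j z).2.val ⟨FrameBundle.mk φ (y z) 1 (e z), hb z⟩ ∈ V
  rw [hval]
  exact hMV g hgM u' hu' θ' hθ'

/-- An equivariant map `Y × EG → Θ_{n+m}`, depending on a parameter, defines a family of sections of
the state bundle, given by its values in the standard frame. -/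
theorem exists_sections {Z : Type*} [TopologicalSpace Z] (F : C(Z × Y × EG, Θ.space (n + m)))
    (hF : ∀ z (g : G) y e, F (z, φ g • y, g • e) = orthIncl n m (φ g) • F (z, y, e)) :
    ∃ S : C(Z × HQ φ Y EG, StateHQ Θ m φ Y EG), ∃ hS : ∀ z, IsStateSection fun b => S (z, b),
      ∀ z y u e, (hS z).eval (FrameBundle.mk φ y u e) = orthIncl n m u • F (z, y, e) := by
  let S : Z × HQ φ Y EG → StateHQ Θ m φ Y EG := fun x =>
    Quotient.liftOn x.2 (fun p => stateAt C p.1 1 p.2 (F (x.1, p.1, p.2))) (by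
      rintro p q ⟨g, rfl⟩
      refine StateHQ.ext_of_frame (y := p.1) (u := 1) (e := p.2) rfl
        (HQ.mk_smul φ g p.1 p.2).symm ?_
      have hfr : FrameBundle.mk φ p.1 1 p.2 = FrameBundle.mk φ (φ g • p.1) (φ g)⁻¹ (g • p.2) := by
        rw [FrameBundle.mk_smul', inv_mul_cancel]
      have h2 : ∀ (f : FrameBundle φ Y EG)
          (hf : f = FrameBundle.mk φ (φ g • p.1) (φ g)⁻¹ (g • p.2))
          (hf' : f.proj = HQ.mk φ (φ g • p.1) (g • p.2)),
          (stateAt C (φ g • p.1) 1 (g • p.2) (F (x.1, φ g • p.1, g • p.2))).2.val ⟨f, hf'⟩ =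
            F (x.1, p.1, p.2) := by
        rintro f rfl hf'
        rw [stateAt_val, hF, smul_smul, ← map_mul]
        simp
      rw [stateAt_val, mul_inv_cancel, map_one, one_smul]
      exact (h2 _ hfr _).symm)
  have hS : ∀ z y e, S (z, HQ.mk φ y e) = stateAt C y 1 e (F (z, y, e)) := fun _ _ _ => rfl
  have hSc : Continuous S := by
    have hq := (IsOpenQuotientMap.id (X := Z)).prodMap
      (HQ.isOpenQuotientMap_mk φ (Y := Y) (EG := EG))
    rw [hq.isQuotientMap.continuous_iff]
    exact (continuous_stateAt C).comp
      (f := fun x : Z × Y × EG => (((x.2.1, 1), x.2.2), F x)) (by fun_prop)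
  have hsec : ∀ z, IsStateSection fun b => S (z, b) := by
    intro z b
    obtain ⟨p, rfl⟩ := Quotient.exists_rep b
    rfl
  refine ⟨⟨S, hSc⟩, hsec, fun z y u e => ?_⟩
  have := stateAt_val (φ := φ) C y 1 u e (F (z, y, e))
  rw [inv_one, mul_one] at this
  exact this

end States

/-! ### The Thom isomorphism -/

section Thom

theorem IsStateSection.eval_mk {Θ : OrthOmegaSpectrum} {G : Type*} [Group G] {n m : ℕ}
    {φ : G →* OrthGroup n} {Y : Type*} [MulAction (OrthGroup n) Y] {EG : Type*} [MulAction G EG]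
    {s : HQ φ Y EG → StateHQ Θ m φ Y EG} (hs : IsStateSection s) (y : Y) (u : OrthGroup n)
    (e : EG) :
    hs.eval (FrameBundle.mk φ y u e) = orthIncl n m u • hs.eval (FrameBundle.mk φ y 1 e) :=
  (s (HQ.mk φ y e)).2.equivariant u
    ⟨FrameBundle.mk φ y 1 e, (hs (HQ.mk φ y e)).symm⟩
    ⟨FrameBundle.mk φ y u e, (hs (HQ.mk φ y e)).symm⟩ (by
      rw [FrameBundle.smul_mk, mul_one])

/-- An invariant map on `EG`, depending on a parameter, descends to `BG`. -/
theorem exists_descend {G EG T Z : Type*} [Group G] [TopologicalSpace EG] [MulAction G EG]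
    [ContinuousConstSMul G EG] [TopologicalSpace T] [TopologicalSpace Z] (H : C(Z × EG, T))
    (hH : ∀ z (g : G) e, H (z, g • e) = H (z, e)) :
    ∃ K : C(Z × ClassSpace G EG, T), ∀ z e, K (z, toClassSpace G e) = H (z, e) := by
  let K : Z × ClassSpace G EG → T := fun x => Quotient.liftOn x.2 (fun e => H (x.1, e)) (by
    rintro _ e ⟨g, rfl⟩
    exact hH _ g e)
  refine ⟨⟨K, ?_⟩, fun _ _ => rfl⟩
  have hq : IsOpenQuotientMap (Prod.map id (toClassSpace G) : Z × EG → Z × ClassSpace G EG) :=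
    IsOpenQuotientMap.id.prodMap MulAction.isOpenQuotientMap_quotientMk
  rw [hq.isQuotientMap.continuous_iff]
  exact H.continuous

variable {Θ : OrthOmegaSpectrum} {G : Type*} [Group G] {n m : ℕ}
  {φ : G →* OrthGroup n} {EG : Type*} [TopologicalSpace EG] [MulAction G EG]

variable (φ) in
/-- The equivariant map `α` from `EG` to `Hom_*(S^n, Θ_{n+m})` lists the values of the section `s`
in the standard frame. -/
def Classifies (α : C(EG, PtMaps n (Θ.space (n + m)) (Θ.vac (n + m))))
    (s : SectionsXInf Θ m φ EG) : Prop :=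
  (∀ (g : G) e, α (g • e) = φ g • α e) ∧
    ∀ e (x : EucSpace n), (α e).1 (x : PtSphere n) = s.1.2.eval (FrameBundle.mk φ x 1 e)

theorem PtMaps.ext_coe {α β : PtMaps n (Θ.space (n + m)) (Θ.vac (n + m))}
    (h : ∀ x : EucSpace n, α.1 (x : PtSphere n) = β.1 (x : PtSphere n)) : α = β := by
  refine Subtype.ext (ContinuousMap.ext fun y => ?_)
  induction y using OnePoint.rec with
  | infty => rw [α.2, β.2]
  | coe x => exact h x

/-- The map `f` on `BG` delooping the values of the section `s`. -/
def IsThomImage (s : SectionsXInf Θ m φ EG) (f : C(ClassSpace G EG, Θ.space m)) : Prop :=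
  ∀ e : EG, ∃ α : PtMaps n (Θ.space (n + m)) (Θ.vac (n + m)),
    (∀ x : EucSpace n, α.1 (x : PtSphere n) = s.1.2.eval (FrameBundle.mk φ x 1 e)) ∧
    f (toClassSpace G e) = Θ.deloop n m α

theorem IsThomImage.apply_eq {s : SectionsXInf Θ m φ EG} {f : C(ClassSpace G EG, Θ.space m)}
    (h : IsThomImage s f) {α : C(EG, PtMaps n (Θ.space (n + m)) (Θ.vac (n + m)))}
    (hα : Classifies φ α s) (e : EG) : f (toClassSpace G e) = Θ.deloop n m (α e) := by
  obtain ⟨β, hβ, hf⟩ := h e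
  rw [hf]
  exact congrArg _ (PtMaps.ext_coe fun x => (hβ x).trans (hα.2 e x).symm)

theorem isThomImage_vac : IsThomImage (vacSectionXInf Θ m φ EG)
    (ContinuousMap.const _ (Θ.vac m)) := fun _ =>
  ⟨⟨ContinuousMap.const _ (Θ.vac (n + m)), rfl⟩, fun _ => rfl, (Θ.deloop_vac n m).symm⟩

variable [ContinuousConstSMul G EG]

theorem exists_isThomImage_of_classifies {s : SectionsXInf Θ m φ EG}
    {α : C(EG, PtMaps n (Θ.space (n + m)) (Θ.vac (n + m)))} (hα : Classifies φ α s) :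
    ∃ f, IsThomImage s f := by
  obtain ⟨K, hK⟩ := exists_descend (G := G) (Z := Unit)
    ⟨fun x : Unit × EG => Θ.deloop n m (α x.2), by fun_prop⟩ (fun _ g e => by
      change Θ.deloop n m (α (g • e)) = Θ.deloop n m (α e)
      rw [hα.1, deloop_smul])
  exact ⟨K.comp ⟨fun b => ((), b), by fun_prop⟩, fun e => ⟨α e, hα.2 e, hK () e⟩⟩

variable [TopologicalSpace G] {ι : Type*} (C : TrivialCover ι G EG)

include C

/-- Families of sections over `(X ∪ {∞}) // G` that are the vacuum at infinity give families of
equivariant maps `EG → Hom_*(S^n, Θ_{n+m})`. -/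
theorem exists_equivariant_of_sections [IsTopologicalGroup G] (hφ : Continuous φ) {Z : Type*}
    [TopologicalSpace Z] (S : C(Z × HQ φ (PtSphere n) EG, StateXInf Θ m φ EG))
    (hS : ∀ z, IsStateSection fun b => S (z, b))
    (hinf : ∀ z u e, (hS z).eval (FrameBundle.mk φ OnePoint.infty u e) = Θ.vac (n + m)) :
    ∃ A : C(Z × EG, PtMaps n (Θ.space (n + m)) (Θ.vac (n + m))),
      (∀ z e y, (A (z, e)).1 y = (hS z).eval (FrameBundle.mk φ y 1 e)) ∧
      ∀ z (g : G) e, A (z, g • e) = φ g • A (z, e) := by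
  have hmk : Continuous fun p : PtSphere n × EG => HQ.mk φ p.1 p.2 := continuous_quot_mk
  have hc : Continuous fun x : (Z × EG) × PtSphere n =>
      (hS x.1.1).eval (FrameBundle.mk φ x.2 1 x.1.2) :=
    continuous_state_val C hφ (j := fun x : (Z × EG) × PtSphere n => S (x.1.1, HQ.mk φ x.2 x.1.2))
      (y := fun x => x.2) (e := fun x => x.1.2)
      (S.continuous.comp ((continuous_fst.comp continuous_fst).prodMk
        (hmk.comp (continuous_snd.prodMk (continuous_snd.comp continuous_fst)))))
      (continuous_snd.comp continuous_fst) (fun x => (hS x.1.1 _).symm)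
  let A : C(Z × EG, PtMaps n (Θ.space (n + m)) (Θ.vac (n + m))) :=
    { toFun := fun x => ⟨ContinuousMap.curry ⟨_, hc⟩ x, hinf x.1 1 x.2⟩
      continuous_toFun := (ContinuousMap.curry ⟨_, hc⟩).continuous.subtype_mk _ }
  have hA : ∀ z e y, (A (z, e)).1 y = (hS z).eval (FrameBundle.mk φ y 1 e) := fun _ _ _ => rfl
  refine ⟨A, hA, fun z g e => Subtype.ext (ContinuousMap.ext fun y => ?_)⟩
  rw [conj_smul_apply, hA, hA, ← IsStateSection.eval_mk]
  congr 1
  rw [← one_mul (φ g), ← FrameBundle.mk_smul' φ, one_mul, smul_inv_smul]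

/-- Families of equivariant maps `EG → Hom_*(S^n, Θ_{n+m})` give families of sections over
`(X ∪ {∞}) // G` that are the vacuum at infinity. -/
theorem exists_sections_of_equivariant {Z : Type*} [TopologicalSpace Z]
    (A : C(Z × EG, PtMaps n (Θ.space (n + m)) (Θ.vac (n + m))))
    (hA : ∀ z (g : G) e, A (z, g • e) = φ g • A (z, e)) :
    ∃ S : C(Z × HQ φ (PtSphere n) EG, StateXInf Θ m φ EG),
      ∃ hS : ∀ z, IsStateSection fun b => S (z, b),
      (∀ z u e, (hS z).eval (FrameBundle.mk φ OnePoint.infty u e) = Θ.vac (n + m)) ∧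
      ∀ z y u e, (hS z).eval (FrameBundle.mk φ y u e) = orthIncl n m u • (A (z, e)).1 y := by
  obtain ⟨S, hS, h⟩ := exists_sections C (φ := φ) (Y := PtSphere n)
    ⟨fun x : Z × PtSphere n × EG => (A (x.1, x.2.2)).1 x.2.1, by fun_prop⟩ (by
      intro z g y e
      change (A (z, g • e)).1 (φ g • y) = orthIncl n m (φ g) • (A (z, e)).1 y
      rw [hA, conj_smul_apply, inv_smul_smul])
  refine ⟨S, hS, fun z u e => ?_, h⟩
  rw [h]
  change orthIncl n m u • (A (z, e)).1 OnePoint.infty = _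
  rw [(A (z, e)).2, Θ.smul_vac]

theorem exists_classifies [IsTopologicalGroup G] (hφ : Continuous φ) (s : SectionsXInf Θ m φ EG) :
    ∃ α, Classifies φ α s := by
  obtain ⟨t, ⟨_, hinf⟩, ht, hts⟩ := s.2
  obtain ⟨A, hA, hAG⟩ := exists_equivariant_of_sections C hφ (Z := Unit)
    (t.comp ⟨Prod.snd, continuous_snd⟩) (fun _ => ht) (fun _ => hinf)
  refine ⟨A.comp ⟨fun e => ((), e), by fun_prop⟩, fun g e => hAG () g e, fun e x => ?_⟩
  exact (hA () e x).trans (hts x 1 e)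

theorem exists_section_of_classifies (α : C(EG, PtMaps n (Θ.space (n + m)) (Θ.vac (n + m))))
    (hα : ∀ (g : G) e, α (g • e) = φ g • α e) :
    ∃ s : SectionsXInf Θ m φ EG, Classifies φ α s := by
  obtain ⟨T, hT, hinf, hval⟩ := exists_sections_of_equivariant C (Z := Unit)
    (α.comp ⟨Prod.snd, continuous_snd⟩) (fun _ => hα)
  obtain ⟨S, hS, h⟩ := exists_sections C (φ := φ) (Y := EucSpace n) (Z := Unit) (m := m)
    ⟨fun x : Unit × EucSpace n × EG => (α x.2.2).1 (x.2.1 : PtSphere n), by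
      have := OnePoint.continuous_coe (X := EucSpace n)
      fun_prop⟩ (by
      intro z g y e
      change (α (g • e)).1 (φ g • (y : PtSphere n)) = orthIncl n m (φ g) • (α e).1 (y : PtSphere n)
      rw [hα, conj_smul_apply, inv_smul_smul])
  refine ⟨⟨⟨S.comp ⟨fun b => ((), b), by fun_prop⟩, hS ()⟩,
    T.comp ⟨fun b => ((), b), by fun_prop⟩, ⟨hT (), hinf ()⟩, hT (), fun x u e => ?_⟩, hα,
    fun e x => ?_⟩
  · exact (hval () x u e).trans (h () x u e).symm
  · refine Eq.trans ?_ (h () x 1 e).symm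
    rw [map_one, one_smul]
    rfl

/-- Sections are homotopic if and only if the equivariant maps that classify them are
equivariantly homotopic. -/
theorem EquivCohXInf.mk_eq_mk_iff [IsTopologicalGroup G] (hφ : Continuous φ)
    {s₀ s₁ : SectionsXInf Θ m φ EG}
    {α₀ α₁ : C(EG, PtMaps n (Θ.space (n + m)) (Θ.vac (n + m)))} (h₀ : Classifies φ α₀ s₀)
    (h₁ : Classifies φ α₁ s₁) :
    EquivCohXInf.mk s₀ = EquivCohXInf.mk s₁ ↔
      ∃ A : C(I × EG, PtMaps n (Θ.space (n + m)) (Θ.vac (n + m))),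
        (∀ e, A (0, e) = α₀ e) ∧ (∀ e, A (1, e) = α₁ e) ∧
        ∀ t (g : G) e, A (t, g • e) = φ g • A (t, e) := by
  refine (Quotient.eq (r := sectionsSetoid Θ m φ EG)).trans ?_
  constructor
  · rintro ⟨t₀, t₁, ⟨-, ht₀, hts₀⟩, ⟨-, ht₁, hts₁⟩, ⟨H⟩⟩
    obtain ⟨A, hA, hAG⟩ := exists_equivariant_of_sections C hφ H.toHomotopy.toContinuousMap
      (fun t => (H.prop t).1) (fun t => (H.prop t).2)
    have hev : ∀ (r : I) (t : C(HQ φ (PtSphere n) EG, StateXInf Θ m φ EG)) (ht : IsStateSection t)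
        (_ : H.toHomotopy.curry r = t) e y,
        (A (r, e)).1 y = ht.eval (FrameBundle.mk φ y 1 e) := by
      rintro r t ht rfl e y
      exact hA r e y
    refine ⟨A, fun e => PtMaps.ext_coe fun x => ?_, fun e => PtMaps.ext_coe fun x => ?_, hAG⟩
    · rw [hev 0 t₀ ht₀ H.toHomotopy.curry_zero, hts₀, h₀.2]
    · rw [hev 1 t₁ ht₁ H.toHomotopy.curry_one, hts₁, h₁.2]
  · rintro ⟨A, hA₀, hA₁, hAG⟩
    obtain ⟨S, hS, hinf, hval⟩ := exists_sections_of_equivariant C A hAG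
    have hext : ∀ (r : I) (s : SectionsXInf Θ m φ EG)
        (α : C(EG, PtMaps n (Θ.space (n + m)) (Θ.vac (n + m)))) (_ : Classifies φ α s)
        (_ : ∀ e, A (r, e) = α e),
        Extends (S.comp ⟨fun b => (r, b), by fun_prop⟩) s.1 := by
      intro r s α hs hα
      refine ⟨⟨hS r, hinf r⟩, hS r, fun x u e => ?_⟩
      rw [IsStateSection.eval_mk s.1.2, ← hs.2, ← hα]
      exact hval r x u e
    exact ⟨_, _, hext 0 s₀ α₀ h₀ hA₀, hext 1 s₁ α₁ h₁ hA₁,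
      ⟨{ toFun := S
         map_zero_left := fun _ => rfl
         map_one_left := fun _ => rfl
         prop' := fun r => ⟨hS r, hinf r⟩ }⟩⟩

/-- Sections are homotopic if and only if their images are homotopic. -/
theorem IsThomImage.homotopic_iff [IsTopologicalGroup G] (hφ : Continuous φ)
    {s₀ s₁ : SectionsXInf Θ m φ EG} {f₀ f₁ : C(ClassSpace G EG, Θ.space m)}
    (h₀ : IsThomImage s₀ f₀) (h₁ : IsThomImage s₁ f₁) :
    EquivCohXInf.mk s₀ = EquivCohXInf.mk s₁ ↔ HtpyClasses.mk f₀ = HtpyClasses.mk f₁ := by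
  obtain ⟨α₀, hα₀⟩ := exists_classifies C hφ s₀
  obtain ⟨α₁, hα₁⟩ := exists_classifies C hφ s₁
  rw [EquivCohXInf.mk_eq_mk_iff C hφ hα₀ hα₁]
  refine Iff.trans ?_ (Quotient.eq (r := ⟨ContinuousMap.Homotopic,
    ContinuousMap.Homotopic.equivalence⟩)).symm
  constructor
  · rintro ⟨A, hA₀, hA₁, hAG⟩
    obtain ⟨K, hK⟩ := exists_descend (G := G) ((Θ.deloop n m).comp A) (fun t g e => by
      change Θ.deloop n m (A (t, g • e)) = Θ.deloop n m (A (t, e))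
      rw [hAG, deloop_smul])
    have hK' : ∀ t e, K (t, toClassSpace G e) = Θ.deloop n m (A (t, e)) := hK
    refine ⟨{ toContinuousMap := K, map_zero_left := fun b => ?_, map_one_left := fun b => ?_ }⟩
    · obtain ⟨e, rfl⟩ : ∃ e, toClassSpace G e = b := Quotient.exists_rep b
      exact (hK' 0 e).trans (by rw [hA₀, h₀.apply_eq hα₀])
    · obtain ⟨e, rfl⟩ : ∃ e, toClassSpace G e = b := Quotient.exists_rep b
      exact (hK' 1 e).trans (by rw [hA₁, h₁.apply_eq hα₁])
  · rintro ⟨H⟩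
    let _ := MulAction.compHom (PtMaps n (Θ.space (n + m)) (Θ.vac (n + m))) φ
    have _ : ContinuousSMul G (PtMaps n (Θ.space (n + m)) (Θ.vac (n + m))) :=
      MulAction.continuousSMul_compHom hφ
    have hq := continuous_toClassSpace (G := G) (EG := EG)
    exact exists_equivariant_homotopy C (Θ.deloop n m) (fun g α => deloop_smul (φ g) α)
      (Θ.deloop_equiv n m) α₀ α₁ hα₀.1 hα₁.1
      ⟨fun z => H (z.1, toClassSpace G z.2), by fun_prop⟩
      (fun e => (H.apply_zero _).trans (h₀.apply_eq hα₀ e))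
      (fun e => (H.apply_one _).trans (h₁.apply_eq hα₁ e))
      (fun t g e => by
        change H (t, toClassSpace G (g • e)) = H (t, toClassSpace G e)
        rw [toClassSpace_smul])

/-- Every map `BG → Θ_m` is homotopic to the image of a section. -/
theorem exists_isThomImage_homotopic [IsTopologicalGroup G] (hφ : Continuous φ)
    (f : C(ClassSpace G EG, Θ.space m)) :
    ∃ (s : SectionsXInf Θ m φ EG) (f' : C(ClassSpace G EG, Θ.space m)),
      IsThomImage s f' ∧ HtpyClasses.mk f' = HtpyClasses.mk f := by
  let _ := MulAction.compHom (PtMaps n (Θ.space (n + m)) (Θ.vac (n + m))) φ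
  have _ : ContinuousSMul G (PtMaps n (Θ.space (n + m)) (Θ.vac (n + m))) :=
    MulAction.continuousSMul_compHom hφ
  obtain ⟨α, H, hα, H0, H1, HG⟩ := exists_equivariant_lift_of_homotopyEquiv C (Θ.deloop n m)
    (fun g α => deloop_smul (φ g) α) (Θ.deloop_equiv n m)
    (f.comp ⟨toClassSpace G, continuous_toClassSpace⟩) (fun g e => by
      change f (toClassSpace G (g • e)) = f (toClassSpace G e)
      rw [toClassSpace_smul])
  obtain ⟨s, hs⟩ := exists_section_of_classifies C (φ := φ) α hα
  obtain ⟨f', hf'⟩ := exists_isThomImage_of_classifies hs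
  obtain ⟨K, hK⟩ := exists_descend (G := G) H HG
  refine ⟨s, f', hf', Quotient.sound ⟨{
    toContinuousMap := K, map_zero_left := fun b => ?_, map_one_left := fun b => ?_ }⟩⟩
  · obtain ⟨e, rfl⟩ : ∃ e, toClassSpace G e = b := Quotient.exists_rep b
    exact (hK 0 e).trans ((H0 e).trans (hf'.apply_eq hs e).symm)
  · obtain ⟨e, rfl⟩ : ∃ e, toClassSpace G e = b := Quotient.exists_rep b
    exact (hK 1 e).trans (H1 e)

end Thom

theorem mainTheorem2 {G : Type*} [Group G] [TopologicalSpace G] [IsTopologicalGroup G]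
    {EG : Type*} [TopologicalSpace EG] [MulAction G EG] [ContinuousSMul G EG]
    (hEG : IsUniversalBundle G EG) (Θ : OrthOmegaSpectrum) (n m : ℕ)
    (φ : G →* OrthGroup n) (hφ : Continuous φ) :
    ∃ Φ : EquivCohXInf Θ m φ EG ≃ HtpyClasses (ClassSpace G EG) (Θ.space m),
      (∀ s : SectionsXInf Θ m φ EG, ∃ f : C(ClassSpace G EG, Θ.space m),
        Φ (EquivCohXInf.mk s) = HtpyClasses.mk f ∧
        ∀ e : EG, ∃ α : PtMaps n (Θ.space (n + m)) (Θ.vac (n + m)),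
          (∀ x : EucSpace n,
            α.1 (x : PtSphere n) = s.1.2.eval (FrameBundle.mk φ x 1 e)) ∧
          f (toClassSpace G e) = Θ.deloop n m α) ∧
      Φ (EquivCohXInf.mk (vacSectionXInf Θ m φ EG)) =
        HtpyClasses.mk (ContinuousMap.const _ (Θ.vac m)) := by
  obtain ⟨ι, ⟨C⟩⟩ := hEG.exists_trivialCover
  have hex : ∀ s : SectionsXInf Θ m φ EG, ∃ f, IsThomImage s f := fun s =>
    (exists_classifies C hφ s).elim fun _ hα => exists_isThomImage_of_classifies hα
  choose F hF using hex
  let Φ : EquivCohXInf Θ m φ EG → HtpyClasses (ClassSpace G EG) (Θ.space m) :=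
    Quotient.lift (fun s => HtpyClasses.mk (F s)) fun s s' h =>
      ((hF s).homotopic_iff C hφ (hF s')).1 (Quotient.sound h)
  have hΦ : Function.Bijective Φ := by
    constructor
    · rintro ⟨s⟩ ⟨s'⟩ h
      exact ((hF s).homotopic_iff C hφ (hF s')).2 h
    · rintro ⟨f⟩
      obtain ⟨s, f', hs, hf'⟩ := exists_isThomImage_homotopic C hφ f
      exact ⟨EquivCohXInf.mk s, (((hF s).homotopic_iff C hφ hs).1 rfl).trans hf'⟩
  exact ⟨Equiv.ofBijective Φ hΦ, fun s => ⟨F s, rfl, hF s⟩,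
    ((hF _).homotopic_iff C hφ isThomImage_vac).1 rfl⟩
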